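/- Let $M,N\ge 1$ be integers. A real $M\times N$ matrix $A$ is called a badly approximable system of linear forms if there is a constant $c>0$ such that $$\|A\mathbf q-\mathbf p\|>c\,\|\mathbf q\|^{-N/M}\qquad\text{for all }\mathbf q\in\mathbb Z^N\setminus\{\mathbf 0\}\text{ and }\mathbf p\in\mathbb Z^M,$$ where $\|\cdot\|$ is the Euclidean norm. Let $\mathrm{Bad}_{\mathbf 0}(M,N)$ denote the set of all such matrices, regarded as a subset of the Euclidean space $\mathbb R^{MN}$ by identifying a matrix with the vector of its entries. Let $d\ge 1$, $S\subseteq\mathbb R^d$ and $0<\beta<1/3$. In the hyperplane $\beta$-absolute game, Bob first chooses a closed ball $B_1\subseteq\mathbb R^d$ of positive radius. Whenever Bob has chosen a ball $B_i$, of radius $\rho(B_i)$, Alice chooses an affine hyperplane $\mathcal L_i\subseteq\mathbb R^d$ and a number $0<\varepsilon_i\le\beta\rho(B_i)$, and Bob then chooses a closed ball $B_{i+1}\subseteq B_i$ with $\rho(B_{i+1})\ge\beta\rho(B_i)$ that is disjoint from the closed $\varepsilon_i$-neighbourhood of $\mathcal L_i$. (Since $\beta<1/3$, Bob always has a legal move.)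 Alice wins if $S\cap\bigcap_i B_i\ne\varnothing$. The set $S$ is hyperplane $\beta$-absolute winning if Alice has a strategy that wins against every play of Bob, and it is hyperplane absolute winning (HAW) if there is $0<\beta_0\le 1/3$ such that $S$ is hyperplane $\beta$-absolute winning for every $0<\beta<\beta_0$. Theorem. For all integers $M,N\ge 1$, the set $\mathrm{Bad}_{\mathbf 0}(M,N)\subseteq\mathbb R^{MN}$ is hyperplane absolute winning. -/

import Mathlib

/-! ### Badly approximable systems of affine forms -/

/-- An integer vector `q ∈ ℤⁿ`, viewed as a vector of `ℝⁿ` with the Euclidean norm. -/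
def intVec {n : ℕ} (q : Fin n → ℤ) : EuclideanSpace ℝ (Fin n) :=
  WithLp.toLp 2 fun j => (q j : ℝ)

/-- The value `A q - x ∈ ℝᴹ` (with the Euclidean norm) at the integer point `q ∈ ℤᴺ` of the system
of `M` affine forms in `N` variables defined by the pair `(A, x)`. -/
def affineForms {M N : ℕ} (A : Matrix (Fin M) (Fin N) ℝ) (x : EuclideanSpace ℝ (Fin M))
    (q : Fin N → ℤ) : EuclideanSpace ℝ (Fin M) :=
  WithLp.toLp 2 (A.mulVec fun j => (q j : ℝ)) - x

/-- `Bad(M,N)`: the pairs `(A, x)` for which there is `c > 0` such that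
`‖(A q - x) - p‖ > c ‖q‖ ^ (-N/M)` for all `q ∈ ℤᴺ \ {0}` and `p ∈ ℤᴹ`. -/
def Bad (M N : ℕ) : Set (Matrix (Fin M) (Fin N) ℝ × EuclideanSpace ℝ (Fin M)) :=
  {Ax | ∃ c : ℝ, 0 < c ∧ ∀ q : Fin N → ℤ, q ≠ 0 → ∀ p : Fin M → ℤ,
    c * ‖intVec q‖ ^ (-((N : ℝ) / (M : ℝ))) < ‖affineForms Ax.1 Ax.2 q - intVec p‖}

/-- The slice `Bad_x(M,N)`: the matrices `A` with `(A, x) ∈ Bad(M,N)`. -/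
def BadSlice (M N : ℕ) (x : EuclideanSpace ℝ (Fin M)) : Set (Matrix (Fin M) (Fin N) ℝ) :=
  {A | (A, x) ∈ Bad M N}

/-- The matrix whose entries are the coordinates of a point of the Euclidean space `ℝ^(MN)`. -/
def toMatrix {M N : ℕ} (v : EuclideanSpace ℝ (Fin M × Fin N)) : Matrix (Fin M) (Fin N) ℝ :=
  Matrix.of fun i j => v (i, j)

/-- `Bad_0(M,N)`, the set of badly approximable systems of linear forms, as a subset of the
Euclidean space `ℝ^(MN)`. -/
def BadZero (M N : ℕ) : Set (EuclideanSpace ℝ (Fin M × Fin N)) :=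
  {v | toMatrix v ∈ BadSlice M N 0}

/-! ### The hyperplane absolute game -/

section Game

variable (E : Type*) [NormedAddCommGroup E] [InnerProductSpace ℝ E]

/-- A move of Bob: a closed ball with positive radius. -/
structure GameBall where
  center : E
  radius : ℝ
  radius_pos : 0 < radius

/-- A move of Alice: an affine subspace together with a thickening parameter. -/
structure GamePlane where
  plane : AffineSubspace ℝ E
  eps : ℝ

variable {E}

/-- The set of points of a ball. -/
def GameBall.toSet (B : GameBall E) : Set E := Metric.closedBall B.center B.radius

/-- The closed `ε`-thickening of the affine subspace `L`. -/
def GamePlane.toSet (A : GamePlane E) : Set E := Metric.cthickening A.eps (A.plane : Set E)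

/-- Alice may answer `B` with the `ε`-thickening of a `k`-dimensional (in particular nonempty)
affine subspace, where `0 < ε ≤ β ρ(B)`. -/
def LegalAlice (k : ℕ) (β : ℝ) (B : GameBall E) (A : GamePlane E) : Prop :=
  (A.plane : Set E).Nonempty ∧ Module.finrank ℝ A.plane.direction = k ∧
    0 < A.eps ∧ A.eps ≤ β * B.radius

/-- After the ball `B` of Bob and the answer `A` of Alice, Bob may move to a ball `B' ⊆ B` with
`ρ(B') ≥ β ρ(B)` that does not meet the set deleted by Alice. -/
def LegalBob (β : ℝ) (B : GameBall E) (A : GamePlane E) (B' : GameBall E) : Prop :=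
  B'.toSet ⊆ B.toSet ∧ β * B.radius ≤ B'.radius ∧ Disjoint B'.toSet A.toSet

variable (E) in
/-- A strategy of Alice: her answer to each finite sequence `B₀, …, Bₙ` of moves of Bob. -/
abbrev AliceStrategy : Type _ := (n : ℕ) → (Fin (n + 1) → GameBall E) → GamePlane E

/-- Alice's answer, under the strategy `σ`, to the first `n + 1` moves `B 0, …, B n` of Bob. -/
def AliceStrategy.answer (σ : AliceStrategy E) (B : ℕ → GameBall E) (n : ℕ) : GamePlane E :=
  σ n fun i => B i

/-- `S` is `k`-dimensionally `β`-absolute winning: Alice has a strategy, consisting of legal moves,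
such that `S ∩ ⋂ₙ Bₙ ≠ ∅` for every sequence of legal moves `B₀, B₁, …` of Bob against it.
This is used for `k < dim E < ∞` and `0 < β < 1/3` only. Bob then always has a legal move, so that
no convention about plays that stop is needed. -/
def IsBetaAbsoluteWinning (k : ℕ) (β : ℝ) (S : Set E) : Prop :=
  ∃ σ : AliceStrategy E,
    (∀ (n : ℕ) (h : Fin (n + 1) → GameBall E), LegalAlice k β (h (Fin.last n)) (σ n h)) ∧
    ∀ B : ℕ → GameBall E, (∀ n, LegalBob β (B n) (σ.answer B n) (B (n + 1))) →
      (S ∩ ⋂ n, (B n).toSet).Nonempty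

/-- `S` is `k`-dimensionally absolute winning: for some `β₀ > 0` (at most `1/3`, since the game is
played with `β < 1/3`), `S` is `k`-dimensionally `β`-absolute winning for all `0 < β < β₀`. -/
def IsAbsoluteWinning (k : ℕ) (S : Set E) : Prop :=
  ∃ β₀ : ℝ, 0 < β₀ ∧ β₀ ≤ 1 / 3 ∧ ∀ β : ℝ, 0 < β → β < β₀ → IsBetaAbsoluteWinning k β S

/-- Hyperplane absolute winning (HAW) sets: the case `k = d - 1` in a space of dimension `d ≥ 1`. -/
def IsHAW (S : Set E) : Prop := IsAbsoluteWinning (Module.finrank ℝ E - 1) S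

end Game

/-!
Badly approximable systems of linear forms are hyperplane absolute winning.

Write `d = M + N`, `μ = N / d` and `ν = M / d`. The size of an integer vector `(q, p)` for a matrix
`A` at scale `ρ` is `max ‖A q - p‖ (ρ ‖q‖)` (`formSize`). A matrix is badly approximable as soon as
all nonzero integer vectors have size at least a constant times `ρ ^ μ`, for scales `ρ → 0` with
bounded ratios (`mem_badZero_of_noSmallVector`). Alice maintains this bound at all matrices of Bob's
ball of radius `ρ`, with the constant `δ κ ^ N`, and simultaneously the analogous bound
`δ κ ^ M ρ ^ ν` for the transposed matrices. Here `δ` depends on `β`, `M` and `N` only, and `κ` is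
small and is chosen after the first ball.

Let `V` be the real span of the integer vectors whose size at the centre of the ball is less than
`2 κ ^ N ρ ^ μ`. The bound for the transposed matrices and Minkowski's convex body theorem imply
that `dim V ≤ M` (`finrank_smallSpan_le`). As the map `(q, p) ↦ A q - p` from `V` goes to a space of
dimension `M`, Alice can arrange within a bounded number of moves that `‖A q - p‖ ≥ c ρ ‖q‖` on `V`,
where `c` does not depend on `κ`. This is done one dimension at a time, and each new dimension costs
the removal of one hyperplane neighbourhood (`exists_controlled_sup`, `forces_controlled`). Next she
does the same for the transposed matrices. When the radius has shrunk sufficiently, the vectors of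
`V` satisfy the bound again, because `A q - p` has grown in comparison with the scale, and all other
integer vectors were so long at the beginning that they satisfy it as well
(`noSmallVector_of_controlled`).

Bob may shrink his balls slowly or not at all. If the radii stay bounded below, then the
intersection of the balls contains a ball, which meets the set because the set is dense: Alice wins
the plays in which Bob shrinks his balls as fast as he can. Otherwise Alice waits whenever the
radius has not decreased by the factor `β`, which leads to a game with ratios of radii in `[β², β]`
(`isBetaAbsoluteWinning_of_forces`).
-/

/-! ### Balls and hyperplanes -/

section Geometry

variable {E : Type*} [NormedAddCommGroup E] [InnerProductSpace ℝ E]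

theorem exists_unit_mul_norm_eq_inner [Nontrivial E] (x : E) :
    ∃ u : E, ‖u‖ = 1 ∧ inner ℝ u x = ‖x‖ := by
  by_cases hx : x = 0
  · obtain ⟨u, hu⟩ := exists_norm_eq E (zero_le_one (α := ℝ))
    exact ⟨u, hu, by simp [hx]⟩
  · have h : ‖x‖ ≠ 0 := norm_ne_zero_iff.2 hx
    refine ⟨‖x‖⁻¹ • x, by simp [norm_smul, h], ?_⟩
    rw [real_inner_smul_left, real_inner_self_eq_norm_sq]
    field_simp

/-- The distance of the centres of nested balls is at most the difference of the radii. -/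
theorem norm_sub_center_le_of_subset [Nontrivial E] {B B' : GameBall E}
    (h : B'.toSet ⊆ B.toSet) : ‖B'.center - B.center‖ + B'.radius ≤ B.radius := by
  obtain ⟨u, hu, hi⟩ := exists_unit_mul_norm_eq_inner (B'.center - B.center)
  have hmem : B'.center + B'.radius • u ∈ B.toSet := by
    apply h
    simp [GameBall.toSet, norm_smul, hu, abs_of_pos B'.radius_pos]
  have h1 : ‖B'.center + B'.radius • u - B.center‖ ≤ B.radius := by
    simpa [GameBall.toSet, dist_eq_norm] using hmem
  have h2 : inner ℝ u (B'.center + B'.radius • u - B.center)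
      ≤ ‖u‖ * ‖B'.center + B'.radius • u - B.center‖ := real_inner_le_norm _ _
  have h3 : B'.center + B'.radius • u - B.center = (B'.center - B.center) + B'.radius • u := by
    abel
  rw [h3, inner_add_right, hi, real_inner_smul_right, real_inner_self_eq_norm_sq, hu, ← h3] at h2
  linarith

theorem radius_le_of_subset [Nontrivial E] {B B' : GameBall E} (h : B'.toSet ⊆ B.toSet) :
    B'.radius ≤ B.radius := by
  linarith [norm_sub_center_le_of_subset h, norm_nonneg (B'.center - B.center)]

variable [FiniteDimensional ℝ E]

/-- The slab `|⟪n, x⟫ - c| ≤ ε ‖n‖` lies in the `ε`-thickening of an affine hyperplane. -/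
theorem exists_hyperplane_slab_subset {n : E} (hn : n ≠ 0) (c : ℝ) :
    ∃ L : AffineSubspace ℝ E, (L : Set E).Nonempty ∧
      Module.finrank ℝ L.direction = Module.finrank ℝ E - 1 ∧
      ∀ ε x, |inner ℝ n x - c| ≤ ε * ‖n‖ → x ∈ Metric.cthickening ε (L : Set E) := by
  have hn' : ‖n‖ ≠ 0 := norm_ne_zero_iff.2 hn
  set p : E := (c / ‖n‖ ^ 2) • n with hp
  have hip : inner ℝ n p = c := by
    rw [hp, real_inner_smul_right, real_inner_self_eq_norm_sq]
    field_simp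
  refine ⟨AffineSubspace.mk' p (ℝ ∙ n)ᗮ, ⟨p, AffineSubspace.self_mem_mk' _ _⟩, ?_, ?_⟩
  · rw [AffineSubspace.direction_mk']
    have := (ℝ ∙ n).finrank_add_finrank_orthogonal
    rw [finrank_span_singleton hn] at this
    omega
  · intro ε x hx
    set y : E := x - ((inner ℝ n x - c) / ‖n‖ ^ 2) • n with hy
    have hyL : y ∈ (AffineSubspace.mk' p (ℝ ∙ n)ᗮ : Set E) := by
      rw [SetLike.mem_coe, AffineSubspace.mem_mk', vsub_eq_sub,
        Submodule.mem_orthogonal_singleton_iff_inner_right, inner_sub_right, hip, hy,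
        inner_sub_right, real_inner_smul_right, real_inner_self_eq_norm_sq]
      field_simp
      ring
    refine Metric.mem_cthickening_of_dist_le x y ε _ hyL ?_
    rw [dist_eq_norm, hy, sub_sub_cancel, norm_smul, Real.norm_eq_abs, abs_div,
      abs_of_nonneg (sq_nonneg ‖n‖), div_mul_eq_mul_div, div_le_iff₀ (by positivity)]
    have := mul_le_mul_of_nonneg_right hx (norm_nonneg n)
    nlinarith

/-- Bob can always answer with a ball of radius `β ρ(B)`, since `β < 1/3`. -/
theorem exists_legalBob [Nontrivial E] {β : ℝ} (hβ0 : 0 < β) (hβ : β < 1 / 3) {B : GameBall E}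
    {A : GamePlane E} (hA : LegalAlice (Module.finrank ℝ E - 1) β B A) :
    ∃ B', LegalBob β B A B' ∧ B'.radius = β * B.radius := by
  obtain ⟨⟨p, hp⟩, hdim, he0, he⟩ := hA
  have hr := B.radius_pos
  -- a unit normal vector of the hyperplane, pointing to the side of the centre of the ball
  obtain ⟨u, hu1, hu, hc⟩ : ∃ u : E, ‖u‖ = 1 ∧ (∀ x ∈ A.plane, inner ℝ u (x - p) = 0) ∧
      0 ≤ inner ℝ u (B.center - p) := by
    have hne : A.plane.directionᗮ ≠ ⊥ := by
      intro h
      have h1 := A.plane.direction.finrank_add_finrank_orthogonal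
      rw [h, finrank_bot] at h1
      have := Module.finrank_pos (R := ℝ) (M := E)
      omega
    obtain ⟨v, hv, hv0⟩ := Submodule.exists_mem_ne_zero_of_ne_bot hne
    have hv0' : ‖v‖ ≠ 0 := norm_ne_zero_iff.2 hv0
    have key : ∀ x ∈ A.plane, inner ℝ v (x - p) = 0 := fun x hx =>
      (Submodule.mem_orthogonal' _ _).1 hv _ (AffineSubspace.vsub_mem_direction hx hp)
    rcases le_total 0 (inner ℝ v (B.center - p)) with h | h
    · refine ⟨‖v‖⁻¹ • v, by simp [norm_smul, hv0'], fun x hx => ?_, ?_⟩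
      · rw [real_inner_smul_left, key x hx, mul_zero]
      · rw [real_inner_smul_left]; positivity
    · refine ⟨-(‖v‖⁻¹ • v), by simp [norm_smul, hv0'], fun x hx => ?_, ?_⟩
      · rw [inner_neg_left, real_inner_smul_left, key x hx, mul_zero, neg_zero]
      · rw [inner_neg_left, real_inner_smul_left, ← mul_neg]
        exact mul_nonneg (by positivity) (by linarith)
  refine ⟨⟨B.center + ((1 - β) * B.radius) • u, β * B.radius, by positivity⟩, ⟨?_, le_rfl, ?_⟩, rfl⟩
  · apply Metric.closedBall_subset_closedBall'
    rw [dist_eq_norm, add_sub_cancel_left, norm_smul, hu1, Real.norm_eq_abs, abs_of_nonneg]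
    · apply le_of_eq; ring
    · apply mul_nonneg <;> linarith
  · rw [Set.disjoint_left]
    intro y hy hyA
    rw [GameBall.toSet, Metric.mem_closedBall, dist_eq_norm] at hy
    have h1 : (1 - 2 * β) * B.radius ≤ inner ℝ u (y - p) := by
      have e : y - p = (y - (B.center + ((1 - β) * B.radius) • u)) +
          ((B.center - p) + ((1 - β) * B.radius) • u) := by abel
      have h2 := neg_le_of_abs_le
        (abs_real_inner_le_norm u (y - (B.center + ((1 - β) * B.radius) • u)))
      rw [e, inner_add_right, inner_add_right, real_inner_smul_right,
        real_inner_self_eq_norm_sq, hu1]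
      rw [hu1] at h2
      nlinarith
    have h2 : A.eps < (1 - 2 * β) * B.radius := by nlinarith
    obtain ⟨z, hz, hzy⟩ := (Metric.mem_thickening_iff).1
      (Metric.cthickening_subset_thickening' (he0.trans h2) h2 _ hyA)
    have h3 : inner ℝ u (y - p) = inner ℝ u (y - z) := by
      have e : y - p = (y - z) + (z - p) := by abel
      rw [e, inner_add_right, hu z hz, add_zero]
    have h4 := real_inner_le_norm u (y - z)
    rw [hu1, one_mul, ← dist_eq_norm] at h4
    linarith

theorem exists_legalAlice [Nontrivial E] {β : ℝ} (hβ0 : 0 < β) (B : GameBall E) :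
    ∃ A, LegalAlice (Module.finrank ℝ E - 1) β B A := by
  obtain ⟨n, hn⟩ := exists_ne (0 : E)
  obtain ⟨L, h1, h2, -⟩ := exists_hyperplane_slab_subset hn 0
  exact ⟨⟨L, β * B.radius⟩, h1, h2, mul_pos hβ0 B.radius_pos, le_rfl⟩

end Geometry

/-! ### Reduction to a game in which the radii shrink at a bounded rate -/

section Reduction

variable {E : Type*} [NormedAddCommGroup E] [InnerProductSpace ℝ E]

/-- A move of Bob in the accelerated game, in which the ratio of consecutive radii is required to
lie in `[β², β]`. It consists of several moves of the original game. -/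
def LegalShrink (β : ℝ) (B : GameBall E) (A : GamePlane E) (B' : GameBall E) : Prop :=
  B'.toSet ⊆ B.toSet ∧ β ^ 2 * B.radius ≤ B'.radius ∧ B'.radius ≤ β * B.radius ∧
    Disjoint B'.toSet A.toSet

/-- In the accelerated game, Alice can ensure that the ball of Bob which is reached from `B` after
exactly `n` further rounds satisfies `P`. -/
def Forces (k : ℕ) (β : ℝ) : ℕ → (GameBall E → Prop) → GameBall E → Prop
  | 0, P, B => P B
  | n + 1, P, B => ∃ A, LegalAlice k β B A ∧ ∀ B', LegalShrink β B A B' → Forces k β n P B'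

/-- The memory of Alice's strategy: an index `idx` fixed at the start of the game, the number `rest`
of rounds of the accelerated game that are left in the current stage after the round being played,
and the ball and the answer that opened this round. -/
structure RoundState (ι : Type*) (E : Type*) [NormedAddCommGroup E] [InnerProductSpace ℝ E]
    (k : ℕ) (β : ℝ) where
  idx : ι
  rest : ℕ
  ball : GameBall E
  move : GamePlane E
  legal : LegalAlice k β ball move

variable {ι : Type*} {k : ℕ} {β : ℝ} {m : ℕ} {Inv : ι → GameBall E → Prop}

/-- The answer of Alice: she repeats the hyperplane chosen at the start of the round. -/
def RoundState.answer (s : RoundState ι E k β) (B : GameBall E) : GamePlane E :=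
  ⟨s.move.plane, min s.move.eps (β * B.radius)⟩

theorem RoundState.answer_legal (hβ : 0 < β) (s : RoundState ι E k β) (B : GameBall E) :
    LegalAlice k β B (s.answer B) :=
  ⟨s.legal.1, s.legal.2.1, lt_min s.legal.2.2.1 (mul_pos hβ B.radius_pos), min_le_right _ _⟩

theorem RoundState.answer_ball (s : RoundState ι E k β) : s.answer s.ball = s.move := by
  simp [RoundState.answer, s.legal.2.2.2]

/-- However Bob finishes the current round of the accelerated game, Alice can still force `Inv` at
the end of the stage, which has `m + 1` rounds. -/
def RoundState.Good (m : ℕ) (Inv : ι → GameBall E → Prop) (s : RoundState ι E k β) : Prop :=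
  s.rest ≤ m ∧ ∀ B', LegalShrink β s.ball s.move B' → Forces k β s.rest (Inv s.idx) B'

/-- `s'` is a good state after the ball `B` has finished the round described by `s`. -/
def RoundState.Next (m : ℕ) (Inv : ι → GameBall E → Prop) (s : RoundState ι E k β) (B : GameBall E)
    (s' : RoundState ι E k β) : Prop :=
  s'.idx = s.idx ∧ s'.ball = B ∧ s'.Good m Inv ∧ (s.rest = 0 ∧ Inv s.idx B ∨ s'.rest + 1 = s.rest)

theorem RoundState.Good.exists_next (hstep : ∀ i B, Inv i B → Forces k β (m + 1) (Inv i) B)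
    {s : RoundState ι E k β} (hs : s.Good m Inv) {B : GameBall E}
    (hB : LegalShrink β s.ball s.move B) : ∃ s', s.Next m Inv B s' := by
  obtain ⟨hm, hF⟩ := hs
  have h := hF B hB
  obtain ⟨i, r, B₀, A₀, hl⟩ := s
  cases r with
  | zero =>
    obtain ⟨A, hA, hA'⟩ := hstep i B h
    exact ⟨⟨i, m, B, A, hA⟩, rfl, rfl, ⟨le_rfl, hA'⟩, Or.inl ⟨rfl, h⟩⟩
  | succ r =>
    obtain ⟨A, hA, hA'⟩ := h
    exact ⟨⟨i, r, B, A, hA⟩, rfl, rfl, ⟨Nat.le_of_succ_le hm, hA'⟩, Or.inr rfl⟩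

open Classical in
/-- The state after Bob's move `B`: unless the radius of `B` is at most `β` times that of the ball
which opened the round, the round goes on. -/
noncomputable def RoundState.update (m : ℕ) (Inv : ι → GameBall E → Prop) (s : RoundState ι E k β)
    (B : GameBall E) : RoundState ι E k β :=
  if h : B.radius ≤ β * s.ball.radius ∧ ∃ s', s.Next m Inv B s' then h.2.choose else s

/-- A strategy may be given by a state that is updated after each move of Bob. -/
theorem exists_strategy_of_update {σ : Type*} (init : GameBall E → σ) (upd : σ → GameBall E → σ)
    (mv : σ → GameBall E → GamePlane E) :
    ∃ S : AliceStrategy E, (∀ n h, ∃ s, S n h = mv s (h (Fin.last n))) ∧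
      ∀ (B : ℕ → GameBall E) (s : ℕ → σ), s 0 = init (B 0) →
        (∀ n, s (n + 1) = upd (s n) (B (n + 1))) → ∀ n, S.answer B n = mv (s n) (B n) := by
  let st : (n : ℕ) → (Fin (n + 1) → GameBall E) → σ := fun n =>
    Nat.rec (motive := fun n => (Fin (n + 1) → GameBall E) → σ) (fun h => init (h 0))
      (fun n ih h => upd (ih fun i => h i.castSucc) (h (Fin.last (n + 1)))) n
  refine ⟨fun n h => mv (st n h) (h (Fin.last n)), fun n h => ⟨_, rfl⟩, fun B s h0 hs n => ?_⟩
  have key : ∀ n, st n (fun i => B i) = s n := by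
    intro n
    induction n with
    | zero => exact h0.symm
    | succ n ih =>
      rw [hs, ← ih]
      rfl
  simp only [AliceStrategy.answer, key, Fin.val_last]

/-- What is known about the state `s` when `B` is the last move of Bob: Alice can still succeed, and
`B` is either the ball that opened the round or a ball that is disjoint from the set deleted then
and still too large to finish the round. -/
def RoundState.Compatible (m : ℕ) (Inv : ι → GameBall E → Prop) (s : RoundState ι E k β)
    (B : GameBall E) : Prop :=
  s.Good m Inv ∧ B.toSet ⊆ s.ball.toSet ∧ β * s.ball.radius < B.radius ∧
    (s.ball = B ∨ Disjoint B.toSet s.move.toSet)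

theorem RoundState.Compatible.legalShrink (hβ0 : 0 < β)
    {s : RoundState ι E k β} {B B' : GameBall E} (h : s.Compatible m Inv B)
    (hB : LegalBob β B (s.answer B) B') (hr : B'.radius ≤ β * s.ball.radius) :
    LegalShrink β s.ball s.move B' := by
  obtain ⟨-, hsub, hrad, hd⟩ := h
  refine ⟨hB.1.trans hsub, ?_, hr, ?_⟩
  · nlinarith [hB.2.1]
  · rcases hd with rfl | hd
    · rw [← s.answer_ball]; exact hB.2.2
    · exact hd.mono_left hB.1

theorem RoundState.Compatible.update_next (hβ0 : 0 < β)
    (hstep : ∀ i B, Inv i B → Forces k β (m + 1) (Inv i) B)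
    {s : RoundState ι E k β} {B B' : GameBall E} (h : s.Compatible m Inv B)
    (hB : LegalBob β B (s.answer B) B') (hr : B'.radius ≤ β * s.ball.radius) :
    s.Next m Inv B' (s.update m Inv B') := by
  have hx : B'.radius ≤ β * s.ball.radius ∧ ∃ s', s.Next m Inv B' s' :=
    ⟨hr, h.1.exists_next hstep (h.legalShrink hβ0 hB hr)⟩
  rw [RoundState.update, dif_pos hx]
  exact hx.2.choose_spec

theorem RoundState.update_eq_self {s : RoundState ι E k β} {B' : GameBall E}
    (hr : β * s.ball.radius < B'.radius) : s.update m Inv B' = s := by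
  rw [RoundState.update, dif_neg]
  exact fun h => absurd h.1 (not_le.2 hr)

theorem RoundState.Compatible.update_compatible (hβ0 : 0 < β) (hβ1 : β < 1)
    (hstep : ∀ i B, Inv i B → Forces k β (m + 1) (Inv i) B)
    {s : RoundState ι E k β} {B B' : GameBall E} (h : s.Compatible m Inv B)
    (hB : LegalBob β B (s.answer B) B') : (s.update m Inv B').Compatible m Inv B' := by
  rcases le_or_gt B'.radius (β * s.ball.radius) with hr | hr
  · obtain ⟨-, hb, hg, -⟩ := h.update_next hβ0 hstep hB hr
    refine ⟨hg, (congrArg GameBall.toSet hb).ge, ?_, Or.inl hb⟩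
    rw [hb]
    nlinarith [B'.radius_pos]
  · rw [RoundState.update_eq_self hr]
    obtain ⟨hg, hsub, hrad, hd⟩ := h
    refine ⟨hg, hB.1.trans hsub, hr, Or.inr ?_⟩
    rcases hd with rfl | hd
    · rw [← s.answer_ball]; exact hB.2.2
    · exact hd.mono_left hB.1

/-- In a play whose radii tend to zero, every round of the accelerated game comes to its end. -/
theorem exists_round_end (hβ0 : 0 < β) {B : ℕ → GameBall E} {s : ℕ → RoundState ι E k β}
    (hs : ∀ n, s (n + 1) = (s n).update m Inv (B (n + 1)))
    (hz : ∀ η > 0, ∃ n, (B n).radius < η) (hmono : Antitone fun n => (B n).radius) (n : ℕ) :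
    ∃ l, s l = s n ∧ (B (l + 1)).radius ≤ β * (s n).ball.radius := by
  have hex : ∃ j, (B (n + j + 1)).radius ≤ β * (s n).ball.radius := by
    obtain ⟨j, hj⟩ := hz _ (mul_pos hβ0 (s n).ball.radius_pos)
    exact ⟨j, (hmono (by omega : j ≤ n + j + 1)).trans hj.le⟩
  classical
  refine ⟨n + Nat.find hex, ?_, Nat.find_spec hex⟩
  have : ∀ j ≤ Nat.find hex, s (n + j) = s n := by
    intro j
    induction j with
    | zero => simp
    | succ j ih =>
      intro hj
      have h1 := ih (by omega)
      rw [← add_assoc, hs, RoundState.update_eq_self, h1]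
      rw [h1]
      exact not_le.1 (Nat.find_min hex (by omega))
  exact this _ le_rfl

/-- In a play whose radii tend to zero, the end of the current stage is reached, at a radius
comparable to the present one. -/
theorem exists_stage_ball (hβ0 : 0 < β) (hβ1 : β < 1)
    (hstep : ∀ i B, Inv i B → Forces k β (m + 1) (Inv i) B)
    {B : ℕ → GameBall E} {s : ℕ → RoundState ι E k β}
    (hc : ∀ n, (s n).Compatible m Inv (B n))
    (hB : ∀ n, LegalBob β (B n) ((s n).answer (B n)) (B (n + 1)))
    (hs : ∀ n, s (n + 1) = (s n).update m Inv (B (n + 1)))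
    (hz : ∀ η > 0, ∃ n, (B n).radius < η) (hmono : Antitone fun n => (B n).radius) :
    ∀ r n, (s n).rest = r → ∃ j, Inv (s n).idx (B j) ∧
      β ^ (2 * (r + 1)) * (s n).ball.radius ≤ (B j).radius ∧
      (B j).radius ≤ β * (s n).ball.radius := by
  intro r
  induction r with
  | zero =>
    intro n hr
    obtain ⟨l, hsl, hl⟩ := exists_round_end hβ0 hs hz hmono n
    have hN := (hc l).update_next hβ0 hstep (hB l) (hsl ▸ hl)
    have hL := (hc l).legalShrink hβ0 (hB l) (hsl ▸ hl)
    rw [hsl] at hN hL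
    obtain ⟨-, -, -, h | h⟩ := hN
    · exact ⟨l + 1, h.2, by simpa using hL.2.1, hl⟩
    · omega
  | succ r ih =>
    intro n hr
    obtain ⟨l, hsl, hl⟩ := exists_round_end hβ0 hs hz hmono n
    have hN := (hc l).update_next hβ0 hstep (hB l) (hsl ▸ hl)
    have hL := (hc l).legalShrink hβ0 (hB l) (hsl ▸ hl)
    rw [← hs, hsl] at hN
    rw [hsl] at hL
    obtain ⟨hi, hb, -, h | h⟩ := hN
    · omega
    · obtain ⟨j, h1, h2, h3⟩ := ih (l + 1) (by omega)
      rw [hi] at h1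
      rw [hb] at h2 h3
      refine ⟨j, h1, ?_, ?_⟩
      · calc β ^ (2 * (r + 1 + 1)) * (s n).ball.radius
            = β ^ (2 * (r + 1)) * (β ^ 2 * (s n).ball.radius) := by ring
          _ ≤ β ^ (2 * (r + 1)) * (B (l + 1)).radius := by gcongr; exact hL.2.1
          _ ≤ _ := h2
      · nlinarith [(B (l + 1)).radius_pos]

/-- A nested sequence of balls whose radii stay away from zero has a ball in its intersection. -/
theorem exists_ball_subset_iInter [Nontrivial E] [FiniteDimensional ℝ E] {B : ℕ → GameBall E}
    (hsub : ∀ n, (B (n + 1)).toSet ⊆ (B n).toSet) {η : ℝ} (hη : 0 < η)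
    (hr : ∀ n, η ≤ (B n).radius) : ∃ C : GameBall E, ∀ n, C.toSet ⊆ (B n).toSet := by
  have hanti : Antitone fun n => (B n).toSet := antitone_nat_of_succ_le hsub
  have hmono : Antitone fun n => (B n).radius := fun a b h => radius_le_of_subset (hanti h)
  -- the limit of the centres lies in each ball `B n` shrunk by `η`
  have hne : (⋂ n, Metric.closedBall (B n).center ((B n).radius - η)).Nonempty := by
    apply IsCompact.nonempty_iInter_of_sequence_nonempty_isCompact_isClosed
    · intro n
      apply Metric.closedBall_subset_closedBall'
      rw [dist_eq_norm]
      linarith [norm_sub_center_le_of_subset (hsub n)]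
    · exact fun n => ⟨_, Metric.mem_closedBall_self (sub_nonneg.2 (hr n))⟩
    · exact isCompact_closedBall _ _
    · exact fun n => Metric.isClosed_closedBall
  obtain ⟨x, hx⟩ := hne
  refine ⟨⟨x, η, hη⟩, fun n => Metric.closedBall_subset_closedBall' ?_⟩
  have := Metric.mem_closedBall.1 (Set.mem_iInter.1 hx n)
  linarith

/-- Suppose that in the accelerated game Alice can restore some invariant every `m + 1` rounds, and
that a point lies in `S` as soon as it lies in balls that satisfy the invariant at all small scales,
up to a bounded factor. Then `S` is `β`-absolute winning: Alice plays the accelerated game and waits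
while the radii do not shrink. -/
theorem isBetaAbsoluteWinning_of_forces [Nontrivial E] [FiniteDimensional ℝ E] {S : Set E}
    (hβ0 : 0 < β) (hβ : β < 1 / 3) (hinit : ∀ B, ∃ i, Inv i B)
    (hstep : ∀ i B, Inv i B → Forces (Module.finrank ℝ E - 1) β (m + 1) (Inv i) B)
    (hwin : ∀ i x ρ₀ c₀, 0 < ρ₀ → 0 < c₀ → (∀ R, 0 < R → R ≤ ρ₀ → ∃ B, Inv i B ∧ x ∈ B.toSet ∧
      c₀ * R ≤ B.radius ∧ B.radius ≤ R) → x ∈ S) :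
    IsBetaAbsoluteWinning (Module.finrank ℝ E - 1) β S := by
  have hβ1 : β < 1 := by linarith
  have hinit' : ∀ B, ∃ s : RoundState ι E (Module.finrank ℝ E - 1) β,
      s.ball = B ∧ s.Good m Inv := by
    intro B
    obtain ⟨i, hi⟩ := hinit B
    obtain ⟨A, hA, h⟩ := hstep i B hi
    exact ⟨⟨i, m, B, A, hA⟩, rfl, le_rfl, h⟩
  choose init hball hgood using hinit'
  obtain ⟨σ, hσ1, hσ2⟩ :=
    exists_strategy_of_update init (RoundState.update m Inv) RoundState.answer
  refine ⟨σ, fun n h => ?_, ?_⟩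
  · obtain ⟨s, hs⟩ := hσ1 n h
    rw [hs]
    exact s.answer_legal hβ0 _
  -- plays against the strategy together with the states
  have compat : ∀ (B : ℕ → GameBall E) (s : ℕ → RoundState ι E (Module.finrank ℝ E - 1) β),
      s 0 = init (B 0) → (∀ n, s (n + 1) = (s n).update m Inv (B (n + 1))) →
      (∀ n, LegalBob β (B n) ((s n).answer (B n)) (B (n + 1))) →
      ∀ n, (s n).Compatible m Inv (B n) := by
    intro B s h0 hs hB n
    induction n with
    | zero =>
      rw [h0]
      refine ⟨hgood _, (congrArg GameBall.toSet (hball _)).ge, ?_, Or.inl (hball _)⟩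
      rw [hball]
      nlinarith [(B 0).radius_pos]
    | succ n ih =>
      rw [hs]
      exact ih.update_compatible hβ0 hβ1 hstep (hB n)
  have win : ∀ (B : ℕ → GameBall E) (s : ℕ → RoundState ι E (Module.finrank ℝ E - 1) β),
      s 0 = init (B 0) → (∀ n, s (n + 1) = (s n).update m Inv (B (n + 1))) →
      (∀ n, LegalBob β (B n) ((s n).answer (B n)) (B (n + 1))) →
      (∀ η > 0, ∃ n, (B n).radius < η) → (S ∩ ⋂ n, (B n).toSet).Nonempty := by
    intro B s h0 hs hB hz
    have hc := compat B s h0 hs hB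
    have hanti : Antitone fun n => (B n).toSet := antitone_nat_of_succ_le fun n => (hB n).1
    have hmono : Antitone fun n => (B n).radius := fun a b h => radius_le_of_subset (hanti h)
    have hidx : ∀ n, (s n).idx = (s 0).idx := by
      intro n
      induction n with
      | zero => rfl
      | succ n ih =>
        rw [hs, ← ih]
        rcases le_or_gt (B (n + 1)).radius (β * (s n).ball.radius) with hr | hr
        · exact ((hc n).update_next hβ0 hstep (hB n) hr).1
        · rw [RoundState.update_eq_self hr]
    obtain ⟨x, hx⟩ : (⋂ n, (B n).toSet).Nonempty :=
      IsCompact.nonempty_iInter_of_sequence_nonempty_isCompact_isClosed _ (fun n => (hB n).1)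
        (fun n => ⟨_, Metric.mem_closedBall_self (B n).radius_pos.le⟩)
        (isCompact_closedBall _ _) (fun n => Metric.isClosed_closedBall)
    refine ⟨x, hwin (s 0).idx x (B 0).radius (β ^ (2 * (m + 1)) * β) (B 0).radius_pos
      (by positivity) fun R hR hR0 => ?_, hx⟩
    -- the first ball of radius at most `R` has radius at least `β R`
    obtain ⟨n, hn1, hn2⟩ : ∃ n, (B n).radius ≤ R ∧ β * R ≤ (B n).radius := by
      classical
      have hex : ∃ n, (B n).radius ≤ R := (hz R hR).imp fun _ h => h.le
      refine ⟨Nat.find hex, Nat.find_spec hex, ?_⟩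
      rcases hf : Nat.find hex with _ | l
      · nlinarith
      · have h1 : R < (B l).radius := not_le.1 (Nat.find_min hex (by omega))
        exact le_trans (by gcongr) (hB l).2.1
    obtain ⟨j, h1, h2, h3⟩ := exists_stage_ball hβ0 hβ1 hstep hc hB hs hz hmono _ n rfl
    rw [hidx] at h1
    have h4 : (B n).radius ≤ (s n).ball.radius := radius_le_of_subset (hc n).2.1
    refine ⟨B j, h1, Set.mem_iInter.1 hx j, ?_, h3.trans ((hc n).2.2.1.le.trans hn1)⟩
    calc β ^ (2 * (m + 1)) * β * R = β ^ (2 * (m + 1)) * (β * R) := by ring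
      _ ≤ β ^ (2 * ((s n).rest + 1)) * (s n).ball.radius := by
        gcongr ?_ * ?_
        · exact pow_le_pow_of_le_one hβ0.le hβ1.le (by have := (hc n).1.1; omega)
        · exact hn2.trans h4
      _ ≤ _ := h2
  -- a play in which the radii decrease geometrically shows that `S` is dense
  have dense : ∀ C : GameBall E, (S ∩ C.toSet).Nonempty := by
    intro C
    choose next hnext hrad using fun (s : RoundState ι E (Module.finrank ℝ E - 1) β) B =>
      exists_legalBob hβ0 hβ (s.answer_legal hβ0 B)
    let play : ℕ → RoundState ι E (Module.finrank ℝ E - 1) β × GameBall E := fun n =>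
      Nat.rec (init C, C) (fun _ q => (q.1.update m Inv (next q.1 q.2), next q.1 q.2)) n
    have hr : ∀ n, (play n).2.radius = β ^ n * C.radius := by
      intro n
      induction n with
      | zero => simp [play]
      | succ n ih => rw [pow_succ', mul_assoc, ← ih]; exact hrad _ _
    obtain ⟨x, hxS, hx⟩ := win (fun n => (play n).2) (fun n => (play n).1) rfl (fun n => rfl)
      (fun n => hnext _ _) fun η hη => by
        obtain ⟨n, hn⟩ := exists_pow_lt_of_lt_one (div_pos hη C.radius_pos) hβ1
        exact ⟨n, by rw [hr]; exact (lt_div_iff₀ C.radius_pos).1 hn⟩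
    exact ⟨x, hxS, Set.mem_iInter.1 hx 0⟩
  intro B hB
  let s : ℕ → RoundState ι E (Module.finrank ℝ E - 1) β := fun n =>
    Nat.rec (init (B 0)) (fun n q => q.update m Inv (B (n + 1))) n
  have hans := hσ2 B s rfl fun n => rfl
  simp only [hans] at hB
  by_cases hz : ∀ η > 0, ∃ n, (B n).radius < η
  · exact win B s rfl (fun n => rfl) hB hz
  · push Not at hz
    obtain ⟨η, hη, h⟩ := hz
    obtain ⟨C, hC⟩ := exists_ball_subset_iInter (fun n => (hB n).1) hη h
    obtain ⟨x, hxS, hx⟩ := dense C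
    exact ⟨x, hxS, Set.mem_iInter.2 fun n => hC n hx⟩

end Reduction

/-! ### Forcing in the accelerated game -/

section Forcing

variable {E : Type*} [NormedAddCommGroup E] [InnerProductSpace ℝ E] {k : ℕ} {β : ℝ}

theorem Forces.mono {P Q : GameBall E → Prop} (h : ∀ B, P B → Q B) :
    ∀ {n : ℕ} {B : GameBall E}, Forces k β n P B → Forces k β n Q B
  | 0, B, hB => h B hB
  | _ + 1, _, ⟨A, hA, hA'⟩ => ⟨A, hA, fun B' hB' => Forces.mono h (hA' B' hB')⟩

theorem Forces.add {P Q : GameBall E → Prop} {b : ℕ} (h : ∀ B, P B → Forces k β b Q B) :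
    ∀ {a : ℕ} {B : GameBall E}, Forces k β a P B → Forces k β (b + a) Q B
  | 0, B, hB => h B hB
  | _ + 1, _, ⟨A, hA, hA'⟩ => ⟨A, hA, fun B' hB' => Forces.add h (hA' B' hB')⟩

/-- Whatever Alice forces, the balls are nested and the radii decrease at a bounded rate. -/
theorem Forces.and_radius (hβ0 : 0 < β) {P : GameBall E → Prop} :
    ∀ {n : ℕ} {B : GameBall E}, Forces k β n P B →
      Forces k β n (fun B' => P B' ∧ B'.toSet ⊆ B.toSet ∧
        β ^ (2 * n) * B.radius ≤ B'.radius ∧ B'.radius ≤ β ^ n * B.radius) B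
  | 0, B, hB => ⟨hB, subset_rfl, by simp, by simp⟩
  | n + 1, B, ⟨A, hA, hA'⟩ => by
    refine ⟨A, hA, fun B' hB' => (Forces.and_radius hβ0 (hA' B' hB')).mono ?_⟩
    rintro B'' ⟨h1, h2, h3, h4⟩
    obtain ⟨g1, g2, g3, -⟩ := hB'
    refine ⟨h1, h2.trans g1, ?_, ?_⟩
    · calc β ^ (2 * (n + 1)) * B.radius = β ^ (2 * n) * (β ^ 2 * B.radius) := by ring
        _ ≤ β ^ (2 * n) * B'.radius := by gcongr
        _ ≤ _ := h3
    · calc B''.radius ≤ β ^ n * B'.radius := h4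
        _ ≤ β ^ n * (β * B.radius) := by gcongr
        _ = _ := by ring

theorem forces_of_forall [Nontrivial E] [FiniteDimensional ℝ E] (hβ0 : 0 < β)
    {P : GameBall E → Prop} (hP : ∀ B, P B) :
    ∀ (n : ℕ) (B : GameBall E), Forces (Module.finrank ℝ E - 1) β n P B
  | 0, B => hP B
  | n + 1, B =>
    let ⟨A, hA⟩ := exists_legalAlice hβ0 B
    ⟨A, hA, fun B' _ => forces_of_forall hβ0 hP n B'⟩

end Forcing

/-! ### Keeping away from the kernels of linear forms -/

section Control

variable {E X Y : Type*} [NormedAddCommGroup E] [InnerProductSpace ℝ E]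
  [NormedAddCommGroup X] [NormedSpace ℝ X] [NormedAddCommGroup Y] [InnerProductSpace ℝ Y]

/-- A space of linear maps `b A : X → Y`, with parameter `A ∈ E`, such that the functional
`A ↦ ⟪w, b A q⟫` has norm `‖w‖ ‖q‖`, like the space of all matrices with the Euclidean norm. -/
def IsTensorLike (b : E →ₗ[ℝ] X →ₗ[ℝ] Y) : Prop :=
  ∀ (w : Y) (q : X), ∃ n : E, ‖n‖ = ‖w‖ * ‖q‖ ∧ ∀ A, inner ℝ n A = inner ℝ w (b A q)

/-- The linear map `(q, p) ↦ b A q - p`. -/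
def formValue (b : E →ₗ[ℝ] X →ₗ[ℝ] Y) (A : E) : X × Y →ₗ[ℝ] Y :=
  b A ∘ₗ LinearMap.fst ℝ X Y - LinearMap.snd ℝ X Y

/-- For all parameters `A` in the ball, `‖b A q - p‖ ≥ r ‖q‖` holds on the subspace `U`. -/
def Controlled (b : E →ₗ[ℝ] X →ₗ[ℝ] Y) (U : Submodule ℝ (X × Y)) (r : ℝ) (B : GameBall E) : Prop :=
  ∀ A ∈ B.toSet, ∀ x ∈ U, r * ‖x.1‖ ≤ ‖formValue b A x‖

variable {b : E →ₗ[ℝ] X →ₗ[ℝ] Y} {β : ℝ}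

theorem formValue_apply (A : E) (x : X × Y) : formValue b A x = b A x.1 - x.2 := rfl

theorem formValue_sub_formValue (A A' : E) (x : X × Y) :
    formValue b A x - formValue b A' x = b (A - A') x.1 := by
  simp [formValue_apply]

theorem IsTensorLike.norm_apply_le (hb : IsTensorLike b) (A : E) (q : X) :
    ‖b A q‖ ≤ ‖A‖ * ‖q‖ := by
  obtain ⟨n, hn, h⟩ := hb (b A q) q
  rcases (norm_nonneg (b A q)).eq_or_lt with h0 | h0
  · rw [← h0]; positivity
  · have h1 := real_inner_le_norm n A
    rw [h, real_inner_self_eq_norm_sq, hn] at h1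
    nlinarith

theorem Controlled.mono {U : Submodule ℝ (X × Y)} {r r' : ℝ} {B B' : GameBall E}
    (h : Controlled b U r B) (hr : r' ≤ r) (hB : B'.toSet ⊆ B.toSet) : Controlled b U r' B' :=
  fun A hA x hx => (mul_le_mul_of_nonneg_right hr (norm_nonneg _)).trans (h A (hB hA) x hx)

/-- Outside a suitable hyperplane neighbourhood, the component of `b A q - p` along the unit vector
`w` is at least `β ρ ‖q‖`. -/
theorem IsTensorLike.exists_legalAlice_inner [FiniteDimensional ℝ E] [Nontrivial E]
    (hb : IsTensorLike b) (hβ0 : 0 < β) (B : GameBall E) {w : Y} (hw : ‖w‖ = 1) (v : X × Y) :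
    ∃ P, LegalAlice (Module.finrank ℝ E - 1) β B P ∧
      ∀ A ∉ P.toSet, β * B.radius * ‖v.1‖ ≤ |inner ℝ w (formValue b A v)| := by
  by_cases hv : v.1 = 0
  · obtain ⟨P, hP⟩ := exists_legalAlice hβ0 B
    exact ⟨P, hP, fun A _ => by simp [hv]⟩
  · obtain ⟨n, hn, h⟩ := hb w v.1
    rw [hw, one_mul] at hn
    have hn0 : n ≠ 0 := norm_ne_zero_iff.1 (hn ▸ norm_ne_zero_iff.2 hv)
    obtain ⟨L, h1, h2, h3⟩ := exists_hyperplane_slab_subset hn0 (inner ℝ w v.2)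
    refine ⟨⟨L, β * B.radius⟩, ⟨h1, h2, mul_pos hβ0 B.radius_pos, le_rfl⟩, fun A hA => ?_⟩
    by_contra! hlt
    refine hA (h3 _ A ?_)
    rw [h, ← inner_sub_right, hn]
    exact hlt.le

/-- One move of Alice enlarges the controlled subspace by one dimension. If `T A x = b A q - p` at
`x = (q, p)` and `A₀` is the centre of the ball, the new vector `v` is chosen so that `T A₀ v` is
orthogonal to `T A₀ U`, and Alice keeps the component of `T A v` along a unit vector `w` orthogonal
to `T A₀ U` away from zero. At a vector `u + v` with `u ∈ U`, the component along `w` is bounded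
below if the first coordinate of `v` dominates; otherwise the control over `U` gives the bound. -/
theorem exists_controlled_sup [FiniteDimensional ℝ E] [Nontrivial E] [FiniteDimensional ℝ X]
    [FiniteDimensional ℝ Y] (hb : IsTensorLike b) (hβ0 : 0 < β) (hβ1 : β < 1)
    {U V : Submodule ℝ (X × Y)} (hUV : U < V)
    (hV : Module.finrank ℝ V ≤ Module.finrank ℝ Y) {B : GameBall E}
    (hU : Controlled b U ((3 + 4 / β) * B.radius) B) :
    ∃ P, LegalAlice (Module.finrank ℝ E - 1) β B P ∧ ∀ B', B'.toSet ⊆ B.toSet →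
      Disjoint B'.toSet P.toSet →
      ∃ U' ≤ V, U < U' ∧ Controlled b U' (β / 4 * B.radius) B' := by
  have hρ := B.radius_pos
  set T := formValue b B.center with hT
  obtain ⟨v₀, hv₀V, hv₀U⟩ := Set.exists_of_ssubset hUV
  obtain ⟨u₀, hu₀, hu₀T⟩ : ∃ u₀ ∈ U, T u₀ = (U.map T).starProjection (T v₀) :=
    Submodule.mem_map.1 (Submodule.starProjection_apply_mem _ _)
  set v := v₀ - u₀ with hv
  have hvU : v ∉ U := fun h => hv₀U (by simpa [hv] using U.add_mem h hu₀)
  have hvT : ∀ u ∈ U, inner ℝ (T u) (T v) = 0 := by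
    intro u hu
    have := (U.map T).sub_starProjection_mem_orthogonal (T v₀)
    rw [hv, map_sub, hu₀T]
    exact (Submodule.mem_orthogonal _ _).1 this _ (Submodule.mem_map_of_mem hu)
  obtain ⟨w, hw1, hwT⟩ : ∃ w : Y, ‖w‖ = 1 ∧ ∀ u ∈ U, inner ℝ w (T u) = 0 := by
    have hne : (U.map T)ᗮ ≠ ⊥ := by
      intro h
      have h1 := (U.map T).finrank_add_finrank_orthogonal
      rw [h, finrank_bot] at h1
      have h2 := Submodule.finrank_map_le T U
      have h3 := Submodule.finrank_lt_finrank_of_lt hUV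
      omega
    obtain ⟨w, hw, hw0⟩ := Submodule.exists_mem_ne_zero_of_ne_bot hne
    have hw0' : ‖w‖ ≠ 0 := norm_ne_zero_iff.2 hw0
    refine ⟨‖w‖⁻¹ • w, by simp [norm_smul, hw0'], fun u hu => ?_⟩
    rw [real_inner_smul_left, (Submodule.mem_orthogonal' _ _).1 hw _ (Submodule.mem_map_of_mem hu),
      mul_zero]
  obtain ⟨P, hP, hPv⟩ := hb.exists_legalAlice_inner hβ0 B hw1 v
  refine ⟨P, hP, fun B' hB' hd => ⟨U ⊔ ℝ ∙ v, ?_, ?_, ?_⟩⟩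
  · refine sup_le hUV.le ((Submodule.span_singleton_le_iff_mem _ _).2 ?_)
    exact V.sub_mem hv₀V (hUV.le hu₀)
  · refine lt_of_le_of_ne le_sup_left fun h => hvU ?_
    rw [h]
    exact Submodule.mem_sup_right (Submodule.mem_span_singleton_self v)
  intro A hA x hx
  obtain ⟨u, hu, y, hy, rfl⟩ := Submodule.mem_sup.1 hx
  obtain ⟨a, rfl⟩ := Submodule.mem_span_singleton.1 hy
  have hAB : ‖A - B.center‖ ≤ B.radius := by
    simpa [GameBall.toSet, dist_eq_norm] using hB' hA
  have hdiff : ∀ z : X × Y, ‖formValue b A z - T z‖ ≤ B.radius * ‖z.1‖ := by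
    intro z
    rw [hT, formValue_sub_formValue]
    exact (hb.norm_apply_le _ _).trans (by gcongr)
  set qu := ‖u.1‖ with hqu
  set qv := ‖(a • v).1‖ with hqv
  have hqx : ‖(u + a • v).1‖ ≤ qu + qv := norm_add_le _ _
  have hqu0 : 0 ≤ qu := norm_nonneg _
  have hqv0 : 0 ≤ qv := norm_nonneg _
  -- the bound along `w`
  have h1 : β * B.radius * qv - B.radius * qu ≤ ‖formValue b A (u + a • v)‖ := by
    have e1 := abs_real_inner_le_norm w (formValue b A (u + a • v))
    have e2 := abs_real_inner_le_norm w (formValue b A u - T u)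
    rw [inner_sub_right, hwT u hu, sub_zero] at e2
    rw [hw1, one_mul] at e1 e2
    have e3 : β * B.radius * qv ≤ |inner ℝ w (formValue b A (a • v))| := by
      rw [map_smul, real_inner_smul_right, abs_mul, hqv, Prod.smul_fst, norm_smul, Real.norm_eq_abs]
      have := mul_le_mul_of_nonneg_left (hPv A (Set.disjoint_left.1 hd hA)) (abs_nonneg a)
      linarith
    rw [map_add, inner_add_right] at e1
    have e4 := abs_sub_abs_le_abs_sub (inner ℝ w (formValue b A (a • v)))
      (-inner ℝ w (formValue b A u))
    rw [abs_neg, sub_neg_eq_add, add_comm] at e4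
    rw [map_add]
    linarith [hdiff u]
  -- the bound from the control over `U`
  have h2 : (3 + 4 / β) * B.radius * qu - B.radius * (qu + qv)
      ≤ ‖formValue b A (u + a • v)‖ := by
    have e1 := hU B.center (Metric.mem_closedBall_self hρ.le) u hu
    have e2 : ‖T u‖ ≤ ‖T (u + a • v)‖ := by
      have := norm_add_sq_eq_norm_sq_add_norm_sq_real (x := T u) (y := T (a • v))
        (by rw [map_smul, real_inner_smul_right, hvT u hu, mul_zero])
      rw [map_add]
      nlinarith [norm_nonneg (T u + T (a • v)), norm_nonneg (T u), norm_nonneg (T (a • v))]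
    have e3 := norm_sub_norm_le (T (u + a • v)) (formValue b A (u + a • v))
    rw [norm_sub_rev] at e3
    have e4 := hdiff (u + a • v)
    have e5 := mul_le_mul_of_nonneg_left hqx hρ.le
    linarith
  have h3 : β / 4 * B.radius * ‖(u + a • v).1‖ ≤ β / 4 * B.radius * (qu + qv) := by gcongr
  refine h3.trans ?_
  rcases le_or_gt qu (β / 2 * qv) with hc | hc
  · have : qu ≤ qv := by nlinarith
    nlinarith [mul_le_mul_of_nonneg_left hc hρ.le, mul_le_mul_of_nonneg_left this
      (mul_pos hβ0 hρ).le]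
  · have h4 : qv ≤ 2 / β * qu := by
      rw [div_mul_eq_mul_div, le_div_iff₀ hβ0]; linarith
    have h5 : 4 / β = 2 * (2 / β) := by ring
    rw [h5] at h2
    have h6 := mul_le_mul_of_nonneg_left h4 hρ.le
    have h7 : β / 4 * B.radius * (qu + qv) ≤ 1 * B.radius * (qu + qv) := by gcongr; linarith
    have h8 : 0 ≤ B.radius * qu := by positivity
    nlinarith

/-- Alice gains control over a subspace of dimension at most `dim Y` in a bounded number of rounds:
after each gain of a dimension she waits until the control is strong with respect to the radius. -/
theorem forces_controlled_aux [FiniteDimensional ℝ E] [Nontrivial E] [FiniteDimensional ℝ X]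
    [FiniteDimensional ℝ Y] (hb : IsTensorLike b) (hβ0 : 0 < β) (hβ1 : β < 1) {l : ℕ}
    (hl : (3 + 4 / β) * β ^ l ≤ β / 4) {V : Submodule ℝ (X × Y)}
    (hV : Module.finrank ℝ V ≤ Module.finrank ℝ Y) (B : GameBall E) (j : ℕ) :
    Forces (Module.finrank ℝ E - 1) β (j * (l + 1)) (fun B' => ∃ U ≤ V,
      min j (Module.finrank ℝ V) ≤ Module.finrank ℝ U ∧
        Controlled b U ((3 + 4 / β) * B'.radius) B') B := by
  induction j with
  | zero =>
    rw [zero_mul]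
    refine ⟨⊥, bot_le, by simp, fun A _ x hx => ?_⟩
    rw [(Submodule.mem_bot ℝ).1 hx]
    simp
  | succ j ih =>
    rw [add_mul, one_mul, add_comm]
    refine Forces.add ?_ ih
    rintro B₁ ⟨U, hUV, hdim, hU⟩
    rcases hUV.eq_or_lt with rfl | hlt
    · refine (Forces.and_radius hβ0 (forces_of_forall hβ0 (fun _ => trivial) _ B₁)).mono ?_
      rintro B₂ ⟨-, hB, -, -⟩
      refine ⟨U, le_rfl, min_le_right _ _, hU.mono ?_ hB⟩
      have := radius_le_of_subset hB
      gcongr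
    · obtain ⟨P, hP, h⟩ := exists_controlled_sup hb hβ0 hβ1 hlt hV hU
      refine ⟨P, hP, fun B₂ hB₂ => ?_⟩
      obtain ⟨U', hU'V, hUU', hU'⟩ := h B₂ hB₂.1 hB₂.2.2.2
      refine (Forces.and_radius hβ0 (forces_of_forall hβ0 (fun _ => trivial) _ B₂)).mono ?_
      rintro B₃ ⟨-, hB, -, hr⟩
      refine ⟨U', hU'V, ?_, hU'.mono ?_ hB⟩
      · have := Submodule.finrank_lt_finrank_of_lt hUU'
        omega
      · have h1 := radius_le_of_subset hB₂.1
        calc (3 + 4 / β) * B₃.radius ≤ (3 + 4 / β) * (β ^ l * B₁.radius) := by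
              gcongr
              exact hr.trans (by gcongr)
          _ = (3 + 4 / β) * β ^ l * B₁.radius := by ring
          _ ≤ _ := by have := B₁.radius_pos; gcongr

theorem forces_controlled [FiniteDimensional ℝ E] [Nontrivial E] [FiniteDimensional ℝ X]
    [FiniteDimensional ℝ Y] (hb : IsTensorLike b) (hβ0 : 0 < β) (hβ1 : β < 1) {l : ℕ}
    (hl : (3 + 4 / β) * β ^ l ≤ β / 4) {V : Submodule ℝ (X × Y)}
    (hV : Module.finrank ℝ V ≤ Module.finrank ℝ Y) (B : GameBall E) :
    Forces (Module.finrank ℝ E - 1) β (Module.finrank ℝ Y * (l + 1))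
      (fun B' => Controlled b V B'.radius B') B := by
  refine (forces_controlled_aux hb hβ0 hβ1 hl hV B _).mono ?_
  rintro B' ⟨U, hUV, hdim, hU⟩
  rw [min_eq_right hV] at hdim
  obtain rfl : U = V := Submodule.eq_of_le_of_finrank_le hUV hdim
  refine hU.mono ?_ subset_rfl
  have := B'.radius_pos
  have h : (0 : ℝ) < 4 / β := by positivity
  nlinarith

end Control

/-! ### A transference principle -/

section Transference

/-- **Minkowski's theorem on linear forms**, for forms of determinant `±1`. -/
theorem exists_int_abs_mulVec_lt {ι : Type*} [Fintype ι] [DecidableEq ι] {F : Matrix ι ι ℝ}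
    (hF : |F.det| = 1) {c : ι → ℝ} (hc : ∀ i, 0 < c i) (h : 1 < ∏ i, c i) :
    ∃ z : ι → ℤ, z ≠ 0 ∧ ∀ i, |F.mulVec (fun j => (z j : ℝ)) i| < c i := by
  classical
  have hdet : LinearMap.det (Matrix.toLin' F) ≠ 0 := by
    rw [LinearMap.det_toLin']
    intro h0
    simp [h0] at hF
  set box : Set (ι → ℝ) := Set.pi Set.univ fun i => Set.Ioo (-c i) (c i) with hbox
  have hvol : MeasureTheory.volume (ZSpan.fundamentalDomain (Pi.basisFun ℝ ι)) *
      2 ^ Module.finrank ℝ (ι → ℝ) < MeasureTheory.volume (Matrix.toLin' F ⁻¹' box) := by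
    rw [MeasureTheory.Measure.addHaar_preimage_linearMap _ hdet, LinearMap.det_toLin', abs_inv, hF,
      hbox, Real.volume_pi_Ioo, ZSpan.fundamentalDomain_pi_basisFun, Real.volume_pi_Ico,
      Module.finrank_fintype_fun_eq_card]
    have e : ∀ i, c i - -c i = 2 * c i := fun i => by ring
    simp only [e, sub_zero, ENNReal.ofReal_one, Finset.prod_const_one, one_mul, inv_one]
    rw [← ENNReal.ofReal_prod_of_nonneg fun i _ => by have := hc i; positivity,
      Finset.prod_mul_distrib, Finset.prod_const, Finset.card_univ]
    have : (2 : ENNReal) ^ Fintype.card ι = ENNReal.ofReal (2 ^ Fintype.card ι) := by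
      rw [ENNReal.ofReal_pow (by norm_num)]; simp
    rw [this]
    refine (ENNReal.ofReal_lt_ofReal_iff (by positivity)).2 ?_
    have : (0 : ℝ) < 2 ^ Fintype.card ι := by positivity
    nlinarith
  have hconv : Convex ℝ (Matrix.toLin' F ⁻¹' box) :=
    (convex_pi fun i _ => convex_Ioo _ _).linear_preimage _
  have hsymm : ∀ x ∈ Matrix.toLin' F ⁻¹' box, -x ∈ Matrix.toLin' F ⁻¹' box := by
    intro x hx
    simp only [hbox, Set.mem_preimage, map_neg, Set.mem_pi, Set.mem_univ, true_imp_iff,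
      Set.mem_Ioo, Pi.neg_apply] at hx ⊢
    exact fun i => ⟨by linarith [(hx i).2], by linarith [(hx i).1]⟩
  have : Countable (Submodule.span ℤ (Set.range (Pi.basisFun ℝ ι))).toAddSubgroup :=
    inferInstanceAs (Countable (Submodule.span ℤ (Set.range (Pi.basisFun ℝ ι))))
  obtain ⟨⟨x, hx⟩, hx0, hxs⟩ :=
    MeasureTheory.exists_ne_zero_mem_lattice_of_measure_mul_two_pow_lt_measure
      (ZSpan.isAddFundamentalDomain' (Pi.basisFun ℝ ι) MeasureTheory.volume) hsymm hconv hvol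
  have hint : ∀ i, ∃ z : ℤ, (z : ℝ) = x i := by
    have := ((Pi.basisFun ℝ ι).mem_span_iff_repr_mem ℤ x).1 hx
    intro i
    simpa using this i
  choose z hz using hint
  have hzx : (fun j => (z j : ℝ)) = x := funext hz
  refine ⟨z, ?_, fun i => ?_⟩
  · rintro rfl
    apply hx0
    ext i
    simp [← hz]
  · rw [hzx]
    exact abs_lt.2 (hxs i (Set.mem_univ i))

/-- An orthonormal basis that is adapted to a subspace `K` and its orthogonal complement. -/
theorem exists_orthonormalBasis_adapted {ι W : Type*} [Fintype ι] [NormedAddCommGroup W]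
    [InnerProductSpace ℝ W] [FiniteDimensional ℝ W] (hι : Module.finrank ℝ W = Fintype.card ι)
    (K : Submodule ℝ W) : ∃ (e : OrthonormalBasis ι ℝ W) (s : Finset ι),
      s.card = Module.finrank ℝ K ∧ (∀ i ∈ s, e i ∈ K) ∧ ∀ i ∉ s, e i ∈ Kᗮ := by
  classical
  obtain ⟨s, -, hs⟩ := Finset.exists_subset_card_eq (s := (Finset.univ : Finset ι))
    (n := Module.finrank ℝ K) (by rw [Finset.card_univ, ← hι]; exact K.finrank_le)
  let f : OrthonormalBasis s ℝ K :=
    (stdOrthonormalBasis ℝ K).reindex (Fintype.equivOfCardEq (by simp [hs]))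
  let v : ι → W := fun i => if h : i ∈ s then (f ⟨i, h⟩ : W) else 0
  have hv : ∀ i : s, v i = f i := fun i => by simp [v]
  have hon : Orthonormal ℝ ((s : Set ι).domRestrict v) := by
    have h1 : (s : Set ι).domRestrict v = fun i : s => (f i : W) := funext hv
    rw [h1]
    exact f.orthonormal.comp_linearIsometry K.subtypeₗᵢ
  obtain ⟨e, he⟩ := hon.exists_orthonormalBasis_extension_of_card_eq hι
  refine ⟨e, s, hs, fun i hi => ?_, fun i hi => ?_⟩
  · rw [he i hi, hv ⟨i, hi⟩]
    exact (f ⟨i, hi⟩).2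
  · rw [Submodule.mem_orthogonal]
    intro k hk
    have h1 := congrArg (K.subtype) (f.sum_repr' ⟨k, hk⟩)
    simp only [map_sum, map_smul, Submodule.subtype_apply] at h1
    rw [← h1, sum_inner]
    refine Finset.sum_eq_zero fun j _ => ?_
    rw [real_inner_smul_left, ← hv j, ← he j j.2, e.inner_eq_zero, mul_zero]
    rintro rfl
    exact hi j.2

variable {M N : ℕ}

/-- For `x = (q, p)`, the size of the vector `(A q - p, ρ q)`. -/
noncomputable def formSize (A : Matrix (Fin M) (Fin N) ℝ) (ρ : ℝ)
    (x : EuclideanSpace ℝ (Fin N) × EuclideanSpace ℝ (Fin M)) : ℝ :=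
  max ‖WithLp.toLp 2 (A.mulVec x.1.ofLp) - x.2‖ (ρ * ‖x.1‖)

/-- Every nonzero integer vector `(q, p)` has size at least `τ`. -/
def NoSmallVector (A : Matrix (Fin M) (Fin N) ℝ) (ρ τ : ℝ) : Prop :=
  ∀ (q : Fin N → ℤ) (p : Fin M → ℤ), q ≠ 0 ∨ p ≠ 0 → τ ≤ formSize A ρ (intVec q, intVec p)

/-- The real span of the integer vectors `(q, p)` of size less than `τ`. -/
def smallSpan (A : Matrix (Fin M) (Fin N) ℝ) (ρ τ : ℝ) :
    Submodule ℝ (EuclideanSpace ℝ (Fin N) × EuclideanSpace ℝ (Fin M)) :=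
  Submodule.span ℝ {x | ∃ q p, x = (intVec q, intVec p) ∧ formSize A ρ x < τ}

/-- The rescaling `(q, p) ↦ (a (A q - p), b q)`. -/
noncomputable def rescale (A : Matrix (Fin M) (Fin N) ℝ) (a b : ℝ) :
    EuclideanSpace ℝ (Fin N) × EuclideanSpace ℝ (Fin M) →ₗ[ℝ] EuclideanSpace ℝ (Fin M ⊕ Fin N) where
  toFun x := WithLp.toLp 2 (Sum.elim (a • (A.mulVec x.1.ofLp - x.2.ofLp)) (b • x.1.ofLp))
  map_add' x y := by
    ext i
    rcases i with i | i
    · simp [Matrix.mulVec_add]; ring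
    · simp
  map_smul' c x := by
    ext i
    rcases i with i | i <;> simp [Matrix.mulVec_smul] <;> ring

theorem norm_toLp_sumElim_sq (u : Fin M → ℝ) (v : Fin N → ℝ) :
    ‖(WithLp.toLp 2 (Sum.elim u v) : EuclideanSpace ℝ (Fin M ⊕ Fin N))‖ ^ 2
      = ‖(WithLp.toLp 2 u : EuclideanSpace ℝ (Fin M))‖ ^ 2
        + ‖(WithLp.toLp 2 v : EuclideanSpace ℝ (Fin N))‖ ^ 2 := by
  simp [EuclideanSpace.norm_sq_eq, Fintype.sum_sum_type]

theorem rescale_injective (A : Matrix (Fin M) (Fin N) ℝ) {a b : ℝ} (ha : a ≠ 0) (hb : b ≠ 0) :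
    Function.Injective (rescale A a b) := by
  rw [← LinearMap.ker_eq_bot, LinearMap.ker_eq_bot']
  rintro ⟨q, p⟩ h
  have hq : q = 0 := by
    ext i
    simpa [rescale, hb] using congrArg (fun x => x.ofLp (Sum.inr i)) h
  subst hq
  have hp : p = 0 := by
    ext i
    simpa [rescale, ha] using congrArg (fun x => x.ofLp (Sum.inl i)) h
  rw [hp]
  rfl

/-- The matrix of `(y, z) ↦ (a y, b (z - Aᵀ y))`. -/
def dualMatrix (A : Matrix (Fin M) (Fin N) ℝ) (a b : ℝ) :
    Matrix (Fin M ⊕ Fin N) (Fin M ⊕ Fin N) ℝ :=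
  Matrix.fromBlocks (a • 1) 0 (-(b • A.transpose)) (b • 1)

theorem dualMatrix_mulVec (A : Matrix (Fin M) (Fin N) ℝ) (a b : ℝ) (x : Fin M ⊕ Fin N → ℝ) :
    (dualMatrix A a b).mulVec x = Sum.elim (a • (x ∘ Sum.inl))
      (b • (x ∘ Sum.inr - A.transpose.mulVec (x ∘ Sum.inl))) := by
  rw [dualMatrix, Matrix.fromBlocks_mulVec]
  congr 1
  · simp [Matrix.smul_mulVec]
  · simp [Matrix.smul_mulVec, Matrix.neg_mulVec, smul_sub]
    abel

theorem det_dualMatrix (A : Matrix (Fin M) (Fin N) ℝ) (a b : ℝ) :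
    (dualMatrix A a b).det = a ^ M * b ^ N := by
  rw [dualMatrix, Matrix.det_fromBlocks_zero₁₂]
  simp

/-- The rescaled vectors `(q, p)` and the rescaled dual vectors `(y, z)` have the pairing
`q ⬝ z - p ⬝ y`, which is an integer at integer vectors. -/
theorem inner_rescale_dualMatrix (A : Matrix (Fin M) (Fin N) ℝ) {a b a' b' : ℝ} (ha : a * a' = 1)
    (hb : b * b' = 1) (x : EuclideanSpace ℝ (Fin N) × EuclideanSpace ℝ (Fin M))
    (y : Fin M ⊕ Fin N → ℝ) :
    inner ℝ (rescale A a b x) (WithLp.toLp 2 ((dualMatrix A a' b').mulVec y))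
      = x.1.ofLp ⬝ᵥ (y ∘ Sum.inr) - x.2.ofLp ⬝ᵥ (y ∘ Sum.inl) := by
  have h : inner ℝ (rescale A a b x) (WithLp.toLp 2 ((dualMatrix A a' b').mulVec y))
      = (Sum.elim (a • (A.mulVec x.1.ofLp - x.2.ofLp)) (b • x.1.ofLp)) ⬝ᵥ
        ((dualMatrix A a' b').mulVec y) := by
    rw [EuclideanSpace.inner_eq_star_dotProduct, dotProduct_comm]
    rfl
  rw [h, dualMatrix_mulVec, sumElim_dotProduct_sumElim]
  simp only [smul_dotProduct, dotProduct_smul, smul_eq_mul, sub_dotProduct, dotProduct_sub]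
  have hA : x.1.ofLp ⬝ᵥ A.transpose.mulVec (y ∘ Sum.inl) = A.mulVec x.1.ofLp ⬝ᵥ (y ∘ Sum.inl) := by
    rw [Matrix.mulVec_transpose, dotProduct_comm, ← Matrix.dotProduct_mulVec, dotProduct_comm]
  rw [hA]
  linear_combination (A.mulVec x.1.ofLp ⬝ᵥ y ∘ Sum.inl - x.2.ofLp ⬝ᵥ y ∘ Sum.inl) * ha +
    (x.1.ofLp ⬝ᵥ y ∘ Sum.inr - A.mulVec x.1.ofLp ⬝ᵥ y ∘ Sum.inl) * hb

theorem abs_inner_le_of_adapted {ι W : Type*} [Fintype ι] [NormedAddCommGroup W]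
    [InnerProductSpace ℝ W] {K : Submodule ℝ W} {e : OrthonormalBasis ι ℝ W}
    {s : Finset ι} (hs : ∀ i ∉ s, e i ∈ Kᗮ) {t : ℝ} {x y : W} (ht0 : 0 ≤ t) (hx : x ∈ K)
    (hy : ∀ i ∈ s, |inner ℝ (e i) y| ≤ t) : |inner ℝ x y| ≤ Fintype.card ι * (‖x‖ * t) := by
  rw [← e.sum_inner_mul_inner]
  refine (Finset.abs_sum_le_sum_abs _ _).trans ?_
  rw [← nsmul_eq_mul, ← Finset.card_univ]
  refine Finset.sum_le_card_nsmul _ _ _ fun i _ => ?_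
  rw [abs_mul]
  by_cases hi : i ∈ s
  · have := abs_real_inner_le_norm x (e i)
    rw [e.norm_eq_one, mul_one] at this
    exact mul_le_mul this (hy i hi) (abs_nonneg _) (norm_nonneg _)
  · rw [(Submodule.mem_orthogonal _ _).1 (hs i hi) x hx, abs_zero, zero_mul]
    positivity

theorem norm_rescale_lt (A : Matrix (Fin M) (Fin N) ℝ) {a b η : ℝ} (ha : 0 < a) (hb : 0 < b)
    {x : EuclideanSpace ℝ (Fin N) × EuclideanSpace ℝ (Fin M)}
    (hx : formSize A (a * b) x < η * a) : ‖rescale A a⁻¹ b x‖ < 2 * η := by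
  obtain ⟨h1, h2⟩ := max_lt_iff.1 hx
  set f : ℝ := ‖WithLp.toLp 2 (A.mulVec x.1.ofLp) - x.2‖ with hf
  have h3 : ‖rescale A a⁻¹ b x‖ ^ 2 = (a⁻¹ * f) ^ 2 + (b * ‖x.1‖) ^ 2 := by
    rw [rescale, LinearMap.coe_mk, AddHom.coe_mk, norm_toLp_sumElim_sq, WithLp.toLp_smul,
      WithLp.toLp_smul, norm_smul, norm_smul, Real.norm_of_nonneg hb.le,
      Real.norm_of_nonneg (inv_nonneg.2 ha.le)]
    rfl
  have h4 : a⁻¹ * f < η := by rwa [inv_mul_lt_iff₀ ha, mul_comm]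
  have h5 : b * ‖x.1‖ < η := by
    refine lt_of_mul_lt_mul_left ?_ ha.le
    linarith
  have h6 : 0 ≤ b * ‖x.1‖ := by positivity
  have h7 : 0 ≤ a⁻¹ * f := by positivity
  refine lt_of_pow_lt_pow_left₀ 2 (by linarith) ?_
  rw [h3]
  nlinarith

theorem formSize_transpose_le (A : Matrix (Fin M) (Fin N) ℝ) {a b : ℝ} (ha : 0 < a) (hb : 0 < b)
    (x : Fin M ⊕ Fin N → ℝ) :
    formSize A.transpose (a * b) (WithLp.toLp 2 (x ∘ Sum.inl), WithLp.toLp 2 (x ∘ Sum.inr))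
      ≤ b * ‖(WithLp.toLp 2 ((dualMatrix A a b⁻¹).mulVec x) :
          EuclideanSpace ℝ (Fin M ⊕ Fin N))‖ := by
  set n : ℝ := ‖(WithLp.toLp 2 ((dualMatrix A a b⁻¹).mulVec x) :
    EuclideanSpace ℝ (Fin M ⊕ Fin N))‖ with hn
  set f : ℝ := ‖(WithLp.toLp 2 (A.transpose.mulVec (x ∘ Sum.inl)) - WithLp.toLp 2 (x ∘ Sum.inr) :
    EuclideanSpace ℝ (Fin N))‖ with hf
  set g : ℝ := ‖(WithLp.toLp 2 (x ∘ Sum.inl) : EuclideanSpace ℝ (Fin M))‖ with hg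
  have h : n ^ 2 = (a * g) ^ 2 + (b⁻¹ * f) ^ 2 := by
    rw [hn, dualMatrix_mulVec, norm_toLp_sumElim_sq, WithLp.toLp_smul, WithLp.toLp_smul, norm_smul,
      norm_smul, Real.norm_of_nonneg ha.le, Real.norm_of_nonneg (inv_nonneg.2 hb.le), hf,
      norm_sub_rev]
    rfl
  have hn0 : 0 ≤ n := norm_nonneg _
  have h1 : b⁻¹ * f ≤ n := le_of_sq_le_sq (by rw [h]; linarith [sq_nonneg (a * g)]) hn0
  have h2 : a * g ≤ n := le_of_sq_le_sq (by rw [h]; linarith [sq_nonneg (b⁻¹ * f)]) hn0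
  refine max_le ((inv_mul_le_iff₀ hb).1 h1) ?_
  calc a * b * g = b * (a * g) := by ring
    _ ≤ b * n := by gcongr

theorem abs_det_of_orthonormalBasis {ι : Type*} [Fintype ι] [DecidableEq ι]
    (e : OrthonormalBasis ι ℝ (EuclideanSpace ℝ ι)) :
    |(Matrix.of fun i j => e i j : Matrix ι ι ℝ).det| = 1 := by
  have h1 : (Matrix.of fun i j => e i j) * (Matrix.of fun i j => e i j).transpose
      = (1 : Matrix ι ι ℝ) := by
    ext i j
    have := orthonormal_iff_ite.1 e.orthonormal i j
    rw [EuclideanSpace.inner_eq_star_dotProduct, dotProduct_comm] at this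
    rw [Matrix.one_apply, ← this]
    rfl
  have h2 := congrArg Matrix.det h1
  rw [Matrix.det_mul, Matrix.det_transpose, Matrix.det_one, ← sq] at h2
  exact (sq_eq_sq₀ (abs_nonneg _) zero_le_one).1 (by rw [sq_abs, h2, one_pow])

/-- Minkowski's theorem for forms that are given in the coordinates of an orthonormal basis. -/
theorem exists_int_abs_inner_lt {ι : Type*} [Fintype ι] [DecidableEq ι] {G : Matrix ι ι ℝ}
    (hG : G.det = 1) (e : OrthonormalBasis ι ℝ (EuclideanSpace ℝ ι)) {s : Finset ι} {t σ : ℝ}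
    (ht : 0 < t) (hσ : 0 < σ) (h : 1 < t ^ s.card * σ ^ (Fintype.card ι - s.card)) :
    ∃ z : ι → ℤ, z ≠ 0 ∧ ∀ i,
      |inner ℝ (e i) (WithLp.toLp 2 (G.mulVec fun j => (z j : ℝ)))| < if i ∈ s then t else σ := by
  obtain ⟨z, hz0, hz⟩ := exists_int_abs_mulVec_lt
    (F := (Matrix.of fun i j => e i j) * G) (c := fun i => if i ∈ s then t else σ)
    (by rw [Matrix.det_mul, hG, mul_one, abs_det_of_orthonormalBasis])
    (fun i => by split_ifs <;> assumption) (by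
      have h1 : ∏ i ∈ s, (if i ∈ s then t else σ) = t ^ s.card := by
        rw [Finset.prod_congr rfl fun i hi => if_pos hi, Finset.prod_const]
      have h2 : ∏ i ∈ sᶜ, (if i ∈ s then t else σ) = σ ^ (Fintype.card ι - s.card) := by
        rw [Finset.prod_congr rfl fun i hi => if_neg (Finset.mem_compl.1 hi), Finset.prod_const,
          Finset.card_compl]
      rwa [← Finset.prod_mul_prod_compl s, h1, h2])
  refine ⟨z, hz0, fun i => ?_⟩
  have h1 := hz i
  rw [← Matrix.mulVec_mulVec] at h1
  rw [EuclideanSpace.inner_eq_star_dotProduct, dotProduct_comm]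
  exact h1

/-- If the dual system has no small integer vectors, then the small integer vectors `(q, p)` span a
subspace of dimension at most `M`. Indeed, if the span `K` of the rescaled small vectors has a
larger dimension, then Minkowski's theorem yields a nonzero integer vector whose rescaled dual
vector `Y` has small components orthogonal to `K`, and components along `K` so small that its
pairings with the small vectors, which are integers, vanish. Then `Y` is orthogonal to `K`, and is
therefore small. -/
theorem finrank_smallSpan_le (hM : 1 ≤ M) (A : Matrix (Fin M) (Fin N) ℝ) {ρ η θ : ℝ}
    (hρ : 0 < ρ) (hη : 0 < η) (hθ : 0 < θ) (hη1 : 2 * (M + N) * η ≤ 1) (hθ1 : θ ≤ 2 * (M + N))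
    (hηθ : (2 * (M + N) * η) ^ (M + 1) < (θ / (2 * (M + N))) ^ (N - 1))
    (hdual : NoSmallVector A.transpose ρ (θ * ρ ^ ((M : ℝ) / (M + N)))) :
    Module.finrank ℝ (smallSpan A ρ (η * ρ ^ ((N : ℝ) / (M + N)))) ≤ M := by
  by_contra! hlt
  have hM' : (1 : ℝ) ≤ M := by exact_mod_cast hM
  have hN' : (0 : ℝ) ≤ N := N.cast_nonneg
  set d : ℝ := M + N with hd
  have hd0 : 0 < d := by positivity
  set a : ℝ := ρ ^ ((N : ℝ) / d) with ha
  set b : ℝ := ρ ^ ((M : ℝ) / d) with hb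
  have ha0 : 0 < a := Real.rpow_pos_of_pos hρ _
  have hb0 : 0 < b := Real.rpow_pos_of_pos hρ _
  have hab : ρ = a * b := by
    rw [ha, hb, ← Real.rpow_add hρ, ← add_div, add_comm (N : ℝ), ← hd, div_self hd0.ne',
      Real.rpow_one]
  -- the exponents `N / d` and `M / d` are those for which the rescaling of the dual vectors has
  -- determinant one
  have hdet : (dualMatrix A a b⁻¹).det = 1 := by
    have : a ^ M = b ^ N := by
      rw [ha, hb, ← Real.rpow_mul_natCast hρ.le, ← Real.rpow_mul_natCast hρ.le]
      congr 1
      ring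
    rw [det_dualMatrix, this, inv_pow, mul_inv_cancel₀ (by positivity)]
  clear_value a b
  subst hab
  set V := smallSpan A (a * b) (η * a) with hV
  set K := V.map (rescale A a⁻¹ b) with hK
  have hKV : Module.finrank ℝ K = Module.finrank ℝ V :=
    (Submodule.equivMapOfInjective _
      (rescale_injective A (inv_ne_zero ha0.ne') hb0.ne') V).finrank_eq.symm
  have hcard : Fintype.card (Fin M ⊕ Fin N) = M + N := by simp
  obtain ⟨e, s, hsc, hsK, hsK'⟩ :=
    exists_orthonormalBasis_adapted (ι := Fin M ⊕ Fin N) finrank_euclideanSpace K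
  rw [hKV] at hsc
  have hs1 : s.card ≤ M + N := hcard ▸ s.card_le_univ
  set t : ℝ := (2 * d * η)⁻¹ with ht
  set σ : ℝ := θ / (2 * d) with hσ
  have ht0 : 0 < t := by positivity
  have hσ0 : 0 < σ := by positivity
  have ht1 : 1 ≤ t := (one_le_inv₀ (by positivity)).2 hη1
  have hσ1 : σ ≤ 1 := (div_le_one (by positivity)).2 hθ1
  -- the bounds `t` along `K` and `σ` orthogonally to `K` define a body that is large enough
  obtain ⟨z, hz0, hz⟩ := exists_int_abs_inner_lt hdet e (s := s) ht0 hσ0 (by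
    rw [hcard]
    calc (1 : ℝ) < t ^ (M + 1) * σ ^ (N - 1) := by
          rw [ht, inv_pow, inv_mul_eq_div, one_lt_div (by positivity)]
          exact hηθ
      _ ≤ t ^ s.card * σ ^ (M + N - s.card) := by
          gcongr ?_ * ?_
          · exact pow_le_pow_right₀ ht1 (by omega)
          · exact pow_le_pow_of_le_one hσ0.le hσ1 (by omega))
  set y : Fin M ⊕ Fin N → ℝ := fun j => (z j : ℝ) with hy
  set Y : EuclideanSpace ℝ (Fin M ⊕ Fin N) :=
    WithLp.toLp 2 ((dualMatrix A a b⁻¹).mulVec y) with hY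
  -- the pairings with the small integer vectors are integers of absolute value less than one
  have hortho : ∀ k ∈ K, inner ℝ k Y = 0 := by
    intro k hk
    rw [hK, hV, smallSpan, Submodule.map_span] at hk
    induction hk using Submodule.span_induction with
    | zero => exact inner_zero_left _
    | add u v _ _ hu hv => rw [inner_add_left, hu, hv, add_zero]
    | smul c u _ hu => rw [real_inner_smul_left, hu, mul_zero]
    | mem k hk =>
      obtain ⟨x, ⟨q, p, rfl, hx⟩, rfl⟩ := hk
      have hxK : rescale A a⁻¹ b (intVec q, intVec p) ∈ K :=
        Submodule.mem_map_of_mem (Submodule.subset_span ⟨q, p, rfl, hx⟩)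
      have hint : inner ℝ (rescale A a⁻¹ b (intVec q, intVec p)) Y
          = ((q ⬝ᵥ (z ∘ Sum.inr) - p ⬝ᵥ (z ∘ Sum.inl) : ℤ) : ℝ) := by
        rw [hY, inner_rescale_dualMatrix A (inv_mul_cancel₀ ha0.ne') (mul_inv_cancel₀ hb0.ne')]
        simp [dotProduct, intVec, hy]
      have habs : |inner ℝ (rescale A a⁻¹ b (intVec q, intVec p)) Y| < 1 := by
        refine (abs_inner_le_of_adapted hsK' ht0.le hxK fun i hi => ?_).trans_lt ?_
        · simpa [hi] using (hz i).le
        · rw [hcard, Nat.cast_add, ← hd]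
          calc d * (‖rescale A a⁻¹ b (intVec q, intVec p)‖ * t) < d * (2 * η * t) := by
                gcongr
                exact norm_rescale_lt A ha0 hb0 hx
            _ = 1 := by rw [ht]; field_simp
      rw [hint] at habs ⊢
      rw [← Int.cast_abs] at habs
      have h0 : |q ⬝ᵥ (z ∘ Sum.inr) - p ⬝ᵥ (z ∘ Sum.inl)| < 1 := by exact_mod_cast habs
      rw [Int.abs_lt_one_iff.1 h0, Int.cast_zero]
  have hcoord : ∀ i, |inner ℝ (e i) Y| ≤ σ := by
    intro i
    by_cases hi : i ∈ s
    · rw [hortho _ (hsK i hi), abs_zero]; exact hσ0.le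
    · simpa [hi] using (hz i).le
  have hYn : ‖Y‖ ≤ θ / 2 := by
    have h1 : ‖Y‖ ≤ ∑ i, ‖(inner ℝ (e i) Y) • e i‖ := by
      conv_lhs => rw [← e.sum_repr' Y]
      exact norm_sum_le _ _
    refine h1.trans ((Finset.sum_le_card_nsmul _ _ σ fun i _ => ?_).trans ?_)
    · rw [norm_smul, e.norm_eq_one, mul_one]
      exact hcoord i
    · rw [Finset.card_univ, hcard, nsmul_eq_mul, hσ, Nat.cast_add, ← hd]
      apply le_of_eq
      field_simp
  have hz1 : z ∘ Sum.inl ≠ 0 ∨ z ∘ Sum.inr ≠ 0 := by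
    by_contra! h
    refine hz0 (funext fun i => ?_)
    rcases i with i | i
    · exact congrFun h.1 i
    · exact congrFun h.2 i
  have h1 : θ * b ≤ b * ‖Y‖ := (hdual _ _ hz1).trans (formSize_transpose_le A ha0 hb0 y)
  nlinarith

end Transference

/-! ### Systems of linear forms and their transposes -/

section MatrixForms

variable {M N : ℕ}

/-- The bilinear map `(A, q) ↦ A q`, where the matrix `A` is given as a point of `ℝ^(MN)`. -/
noncomputable def mulVecForm (M N : ℕ) : EuclideanSpace ℝ (Fin M × Fin N) →ₗ[ℝ]
    EuclideanSpace ℝ (Fin N) →ₗ[ℝ] EuclideanSpace ℝ (Fin M) :=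
  LinearMap.mk₂ ℝ (fun v q => WithLp.toLp 2 ((toMatrix v).mulVec q.ofLp))
    (fun v v' q => by
      ext i; simp [toMatrix, Matrix.mulVec, dotProduct, add_mul, Finset.sum_add_distrib])
    (fun c v q => by
      ext i; simp [toMatrix, Matrix.mulVec, dotProduct, mul_assoc, Finset.mul_sum])
    (fun v q q' => by ext i; simp [Matrix.mulVec_add])
    (fun c v q => by ext i; simp [Matrix.mulVec_smul])

/-- The bilinear map `(A, y) ↦ Aᵀ y`, where the matrix `A` is given as a point of `ℝ^(MN)`. -/
noncomputable def transposeMulVecForm (M N : ℕ) : EuclideanSpace ℝ (Fin M × Fin N) →ₗ[ℝ]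
    EuclideanSpace ℝ (Fin M) →ₗ[ℝ] EuclideanSpace ℝ (Fin N) :=
  LinearMap.mk₂ ℝ (fun v q => WithLp.toLp 2 ((toMatrix v).transpose.mulVec q.ofLp))
    (fun v v' q => by
      ext i; simp [toMatrix, Matrix.mulVec, dotProduct, add_mul, Finset.sum_add_distrib])
    (fun c v q => by
      ext i; simp [toMatrix, Matrix.mulVec, dotProduct, mul_assoc, Finset.mul_sum])
    (fun v q q' => by ext i; simp [Matrix.mulVec_add])
    (fun c v q => by ext i; simp [Matrix.mulVec_smul])

theorem norm_toLp_mul (x : EuclideanSpace ℝ (Fin M)) (y : EuclideanSpace ℝ (Fin N)) :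
    ‖(WithLp.toLp 2 fun ij : Fin M × Fin N => x ij.1 * y ij.2 :
      EuclideanSpace ℝ (Fin M × Fin N))‖ = ‖x‖ * ‖y‖ := by
  rw [← sq_eq_sq₀ (norm_nonneg _) (by positivity), mul_pow]
  simp only [EuclideanSpace.norm_sq_eq, norm_mul, mul_pow, Fintype.sum_prod_type,
    Finset.sum_mul_sum]

theorem isTensorLike_mulVecForm : IsTensorLike (mulVecForm M N) := by
  intro w q
  refine ⟨WithLp.toLp 2 fun ij => w ij.1 * q ij.2, norm_toLp_mul w q, fun A => ?_⟩
  simp only [PiLp.inner_apply, Fintype.sum_prod_type, mulVecForm, LinearMap.mk₂_apply, toMatrix,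
    Matrix.mulVec, dotProduct, Matrix.of_apply, RCLike.inner_apply, conj_trivial, Finset.sum_mul]
  exact Finset.sum_congr rfl fun i _ => Finset.sum_congr rfl fun j _ => by ring

theorem isTensorLike_transposeMulVecForm : IsTensorLike (transposeMulVecForm M N) := by
  intro w q
  refine ⟨WithLp.toLp 2 fun ij => q ij.1 * w ij.2, by rw [norm_toLp_mul, mul_comm], fun A => ?_⟩
  simp only [PiLp.inner_apply, Fintype.sum_prod_type, transposeMulVecForm, LinearMap.mk₂_apply,
    toMatrix, Matrix.mulVec, dotProduct, Matrix.of_apply, Matrix.transpose_apply,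
    RCLike.inner_apply, conj_trivial, Finset.sum_mul]
  rw [Finset.sum_comm]
  exact Finset.sum_congr rfl fun i _ => Finset.sum_congr rfl fun j _ => by ring

theorem one_le_norm_intVec {n : ℕ} {q : Fin n → ℤ} (hq : q ≠ 0) : 1 ≤ ‖intVec q‖ := by
  obtain ⟨i, hi⟩ := Function.ne_iff.1 hq
  have h1 : ‖(intVec q).ofLp i‖ ≤ ‖intVec q‖ := PiLp.norm_apply_le _ i
  refine le_trans ?_ h1
  rw [intVec, Real.norm_eq_abs, ← Int.cast_abs]
  exact_mod_cast Int.one_le_abs hi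

theorem noSmallVector_min (A : Matrix (Fin M) (Fin N) ℝ) {ρ : ℝ} (hρ : 0 < ρ) :
    NoSmallVector A ρ (min ρ 1) := by
  intro q p h
  by_cases hq : q = 0
  · refine (min_le_right _ _).trans (le_trans ?_ (le_max_left _ _))
    have hp : p ≠ 0 := by simpa [hq] using h
    have : (WithLp.toLp 2 (A.mulVec (intVec q).ofLp) - intVec p : EuclideanSpace ℝ (Fin M))
        = -intVec p := by
      subst hq
      have h0 : (intVec (0 : Fin N → ℤ)).ofLp = 0 := by ext; simp [intVec]
      simp [h0]
    rw [this, norm_neg]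
    exact one_le_norm_intVec hp
  · refine (min_le_left _ _).trans (le_trans ?_ (le_max_right _ _))
    exact le_mul_of_one_le_right hρ.le (one_le_norm_intVec hq)

theorem NoSmallVector.mono {A : Matrix (Fin M) (Fin N) ℝ} {ρ τ τ' : ℝ} (h : NoSmallVector A ρ τ)
    (hτ : τ' ≤ τ) : NoSmallVector A ρ τ' := fun q p hqp => hτ.trans (h q p hqp)

/-- A matrix without small vectors at a sequence of scales that tends to zero at a bounded rate is
badly approximable. -/
theorem mem_badZero_of_noSmallVector (hM : 1 ≤ M) (hN : 1 ≤ N)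
    {x : EuclideanSpace ℝ (Fin M × Fin N)} {D ρ₀ c₀ : ℝ} (hD : 0 < D) (hρ₀ : 0 < ρ₀) (hc₀ : 0 < c₀)
    (h : ∀ R, 0 < R → R ≤ ρ₀ → ∃ ρ, c₀ * R ≤ ρ ∧ ρ ≤ R ∧
      NoSmallVector (toMatrix x) ρ (D * ρ ^ ((N : ℝ) / (M + N)))) : x ∈ BadZero M N := by
  have hM' : (0 : ℝ) < M := by exact_mod_cast hM
  have hN' : (0 : ℝ) < N := by exact_mod_cast hN
  set μ : ℝ := (N : ℝ) / (M + N) with hμ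
  set ν : ℝ := (M : ℝ) / (M + N) with hν
  have hμ0 : 0 < μ := by positivity
  have hν0 : 0 < ν := by positivity
  have hμν : μ + ν = 1 := by rw [hμ, hν]; field_simp; ring
  set R₀ : ℝ := min ρ₀ ((D / 2) ^ (1 / ν)) with hR₀
  have hR₀0 : 0 < R₀ := lt_min hρ₀ (by positivity)
  refine ⟨D * (c₀ * R₀) ^ μ / 2, by positivity, fun q hq p => ?_⟩
  have hq1 := one_le_norm_intVec hq
  have hq0 : 0 < ‖intVec q‖ := by linarith
  -- at the scale `R` the term `ρ ‖q‖` falls below the lower bound for the size of `(q, p)`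
  set R : ℝ := R₀ * ‖intVec q‖ ^ (-(1 / ν)) with hR
  have hR0 : 0 < R := by positivity
  have hRle : R ≤ R₀ := mul_le_of_le_one_right hR₀0.le
    (Real.rpow_le_one_of_one_le_of_nonpos hq1 (by simp [hν0.le]))
  obtain ⟨ρ, h1, h2, h3⟩ := h R hR0 (hRle.trans (min_le_left _ _))
  have hρ : 0 < ρ := lt_of_lt_of_le (by positivity) h1
  have hsmall : ρ * ‖intVec q‖ < D * ρ ^ μ := by
    have e1 : ρ ^ ν * ‖intVec q‖ ≤ D / 2 := by
      calc ρ ^ ν * ‖intVec q‖ ≤ R ^ ν * ‖intVec q‖ := by gcongr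
        _ = R₀ ^ ν := by
          rw [hR, Real.mul_rpow hR₀0.le (by positivity), ← Real.rpow_mul hq0.le, neg_mul,
            one_div_mul_cancel hν0.ne', Real.rpow_neg_one]
          field_simp
        _ ≤ ((D / 2) ^ (1 / ν)) ^ ν := by gcongr; exact min_le_right _ _
        _ = D / 2 := by
          rw [← Real.rpow_mul (by positivity), one_div_mul_cancel hν0.ne', Real.rpow_one]
    have e2 : ρ = ρ ^ μ * ρ ^ ν := by rw [← Real.rpow_add hρ, hμν, Real.rpow_one]
    have e3 : 0 < ρ ^ μ := by positivity
    calc ρ * ‖intVec q‖ = ρ ^ μ * (ρ ^ ν * ‖intVec q‖) := by rw [← mul_assoc, ← e2]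
      _ ≤ ρ ^ μ * (D / 2) := by gcongr
      _ < D * ρ ^ μ := by nlinarith
  have hval : affineForms (toMatrix x) 0 q - intVec p
      = WithLp.toLp 2 ((toMatrix x).mulVec (intVec q).ofLp) - intVec p := by
    simp [affineForms, intVec]
  rw [hval]
  have h4 : D * ρ ^ μ ≤ ‖WithLp.toLp 2 ((toMatrix x).mulVec (intVec q).ofLp) - intVec p‖ := by
    rcases le_max_iff.1 (h3 q p (Or.inl hq)) with h | h
    · exact h
    · exact absurd h (not_le.2 hsmall)
  refine lt_of_lt_of_le ?_ h4
  have hexp : -((N : ℝ) / M) = -(1 / ν) * μ := by rw [hμ, hν]; field_simp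
  have h5 : (c₀ * R₀) ^ μ * ‖intVec q‖ ^ (-((N : ℝ) / M)) = (c₀ * R) ^ μ := by
    rw [hR, ← mul_assoc, Real.mul_rpow (x := c₀ * R₀) (by positivity) (by positivity), hexp,
      Real.rpow_mul hq0.le]
  have h6 : (c₀ * R) ^ μ ≤ ρ ^ μ := by gcongr
  have h7 : 0 < (c₀ * R) ^ μ := by positivity
  calc D * (c₀ * R₀) ^ μ / 2 * ‖intVec q‖ ^ (-((N : ℝ) / M))
      = D / 2 * ((c₀ * R₀) ^ μ * ‖intVec q‖ ^ (-((N : ℝ) / M))) := by ring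
    _ = D / 2 * (c₀ * R) ^ μ := by rw [h5]
    _ < D * (c₀ * R) ^ μ := by nlinarith
    _ ≤ D * ρ ^ μ := by gcongr

end MatrixForms

/-! ### The invariant of Alice's strategy -/

section Invariant

variable {E : Type*} [NormedAddCommGroup E] [InnerProductSpace ℝ E] {M N : ℕ}

/-- Control over the span of the small vectors of the centre of `B` makes the lower bound for the
size of integer vectors survive in the smaller ball `B'`. A small vector has grown at the scale of
`B'` since `A q - p` has; the other vectors are so large at the scale of `B` that the loss of a
factor `δ` does no harm. -/
theorem noSmallVector_of_controlled {b : E →ₗ[ℝ] EuclideanSpace ℝ (Fin N) →ₗ[ℝ]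
      EuclideanSpace ℝ (Fin M)} (hb : IsTensorLike b) {mat : E → Matrix (Fin M) (Fin N) ℝ}
    (hmat : ∀ v q, b v q = WithLp.toLp 2 ((mat v).mulVec q.ofLp)) {B B' : GameBall E}
    (hBB' : B'.toSet ⊆ B.toSet) {δ ε c g μ : ℝ} (hμ : 0 ≤ μ) (hδ0 : 0 < δ) (hδ1 : δ ≤ 1)
    (hε : 0 < ε) (hc0 : 0 < c) (hc1 : c ≤ 1) (hg0 : 0 < g) (hgc : g ^ μ ≤ c)
    (hr : δ * B.radius ≤ B'.radius) (hr' : B'.radius ≤ g * B.radius)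
    (hctrl : Controlled b (smallSpan (mat B.center) B.radius (2 * ε * B.radius ^ μ))
      (c * B.radius) B') {v : E} (hv : v ∈ B'.toSet)
    (hsmall : NoSmallVector (mat v) B.radius (δ * ε * B.radius ^ μ)) :
    NoSmallVector (mat v) B'.radius (δ * ε * B'.radius ^ μ) := by
  intro q p hqp
  have hρ := B.radius_pos
  have hρ' := B'.radius_pos
  set x : EuclideanSpace ℝ (Fin N) × EuclideanSpace ℝ (Fin M) := (intVec q, intVec p) with hx
  have hval : ∀ u, WithLp.toLp 2 ((mat u).mulVec x.1.ofLp) - x.2 = formValue b u x := by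
    intro u
    rw [formValue_apply, hmat]
  have hpow : B'.radius ^ μ ≤ c * B.radius ^ μ := by
    calc B'.radius ^ μ ≤ (g * B.radius) ^ μ := by gcongr
      _ = g ^ μ * B.radius ^ μ := Real.mul_rpow hg0.le hρ.le
      _ ≤ c * B.radius ^ μ := by gcongr
  have hpow0 : 0 < B.radius ^ μ := by positivity
  have hold := hsmall q p hqp
  have hx0 : 0 ≤ ‖x.1‖ := norm_nonneg _
  by_cases hlt : formSize (mat B.center) B.radius x < 2 * ε * B.radius ^ μ
  · have h1 := hctrl v hv x (Submodule.subset_span ⟨q, p, rfl, hlt⟩)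
    have h2 : c * formSize (mat v) B.radius x ≤ ‖formValue b v x‖ := by
      rw [formSize, hval, mul_max_of_nonneg _ _ hc0.le]
      refine max_le ?_ (by rwa [← mul_assoc])
      exact mul_le_of_le_one_left (norm_nonneg _) hc1
    calc δ * ε * B'.radius ^ μ ≤ δ * ε * (c * B.radius ^ μ) := by gcongr
      _ = c * (δ * ε * B.radius ^ μ) := by ring
      _ ≤ c * formSize (mat v) B.radius x := by gcongr
      _ ≤ ‖formValue b v x‖ := h2
      _ ≤ formSize (mat v) B'.radius x := by rw [formSize, hval]; exact le_max_left _ _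
  · rw [not_lt] at hlt
    have h1 : formSize (mat B.center) B.radius x ≤ 2 * formSize (mat v) B.radius x := by
      have e1 := le_max_left ‖formValue b v x‖ (B.radius * ‖x.1‖)
      have e2 := le_max_right ‖formValue b v x‖ (B.radius * ‖x.1‖)
      have e3 : ‖formValue b B.center x - formValue b v x‖ ≤ B.radius * ‖x.1‖ := by
        rw [formValue_sub_formValue]
        refine (hb.norm_apply_le _ _).trans ?_
        gcongr
        have := hBB' hv
        rwa [GameBall.toSet, Metric.mem_closedBall, dist_comm, dist_eq_norm] at this
      have e4 := norm_sub_norm_le (formValue b B.center x) (formValue b v x)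
      rw [formSize, formSize, hval, hval]
      have e5 : 0 ≤ B.radius * ‖x.1‖ := by positivity
      exact max_le (by linarith) (by linarith)
    have h2 : δ * formSize (mat v) B.radius x ≤ formSize (mat v) B'.radius x := by
      rw [formSize, formSize, hval, mul_max_of_nonneg _ _ hδ0.le]
      refine max_le_max (mul_le_of_le_one_left (norm_nonneg _) hδ1) ?_
      rw [← mul_assoc]
      gcongr
    have h3 : B'.radius ^ μ ≤ B.radius ^ μ := hpow.trans (mul_le_of_le_one_left hpow0.le hc1)
    calc δ * ε * B'.radius ^ μ ≤ δ * ε * B.radius ^ μ := by gcongr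
      _ = δ * (ε * B.radius ^ μ) := by ring
      _ ≤ δ * formSize (mat v) B.radius x := by gcongr; linarith
      _ ≤ _ := h2

/-- Alice can gain control over two subspaces, one for each of two systems of forms, and then wait
for `w` rounds. -/
theorem forces_controlled_pair [FiniteDimensional ℝ E] [Nontrivial E] {β : ℝ}
    {b : E →ₗ[ℝ] EuclideanSpace ℝ (Fin N) →ₗ[ℝ] EuclideanSpace ℝ (Fin M)}
    {b' : E →ₗ[ℝ] EuclideanSpace ℝ (Fin M) →ₗ[ℝ] EuclideanSpace ℝ (Fin N)}
    (hb : IsTensorLike b) (hb' : IsTensorLike b') (hβ0 : 0 < β) (hβ1 : β < 1) {l : ℕ}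
    (hl : (3 + 4 / β) * β ^ l ≤ β / 4)
    {V : Submodule ℝ (EuclideanSpace ℝ (Fin N) × EuclideanSpace ℝ (Fin M))}
    {V' : Submodule ℝ (EuclideanSpace ℝ (Fin M) × EuclideanSpace ℝ (Fin N))}
    (hV : Module.finrank ℝ V ≤ M) (hV' : Module.finrank ℝ V' ≤ N) (B : GameBall E) {n : ℕ}
    (hn : n = N * (l + 1) + M * (l + 1)) (w : ℕ) :
    Forces (Module.finrank ℝ E - 1) β (w + n) (fun B' =>
      (Controlled b V (β ^ (2 * n) * B.radius) B' ∧
        Controlled b' V' (β ^ (2 * n) * B.radius) B') ∧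
      B'.toSet ⊆ B.toSet ∧ β ^ (2 * (w + n)) * B.radius ≤ B'.radius ∧
      B'.radius ≤ β ^ (w + n) * B.radius) B := by
  have h1 := forces_controlled hb hβ0 hβ1 hl (V := V) (by simpa using hV) B
  rw [finrank_euclideanSpace_fin] at h1
  have h2 : Forces (Module.finrank ℝ E - 1) β n
      (fun B' => Controlled b V B'.radius B' ∧ Controlled b' V' B'.radius B') B := by
    rw [hn]
    refine Forces.add (fun B₁ hB₁ => ?_) h1
    have h3 := forces_controlled hb' hβ0 hβ1 hl (V := V') (by simpa using hV') B₁
    rw [finrank_euclideanSpace_fin] at h3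
    refine (Forces.and_radius hβ0 h3).mono ?_
    rintro B₂ ⟨h4, h5, -, -⟩
    exact ⟨hB₁.mono (radius_le_of_subset h5) h5, h4⟩
  refine Forces.and_radius hβ0 (Forces.add ?_ (Forces.and_radius hβ0 h2))
  rintro B₂ ⟨⟨h3, h4⟩, -, h5, -⟩
  refine (Forces.and_radius hβ0 (forces_of_forall hβ0 (fun _ => trivial) w B₂)).mono ?_
  rintro B₃ ⟨-, h6, -, -⟩
  exact ⟨h3.mono h5 h6, h4.mono h5 h6⟩

/-- The choice of the lower bounds `δ κ ^ N` and `δ κ ^ M` for the sizes of the integer vectors of a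
system and of its transpose is consistent with the transference principle, since
`N (M + 1) > M (N - 1)`. -/
theorem exists_transference_const (hM : 1 ≤ M) (hN : 1 ≤ N) {δ : ℝ} (hδ0 : 0 < δ) :
    ∃ κ₀ : ℝ, 0 < κ₀ ∧ κ₀ ≤ 1 ∧ ∀ κ, 0 < κ → κ ≤ κ₀ →
      2 * ((M : ℝ) + N) * (2 * κ ^ N) ≤ 1 ∧
      (2 * ((M : ℝ) + N) * (2 * κ ^ N)) ^ (M + 1) < (δ * κ ^ M / (2 * (M + N))) ^ (N - 1) := by
  have hd : (0 : ℝ) < (M : ℝ) + N := by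
    have : (1 : ℝ) ≤ M := by exact_mod_cast hM
    positivity
  set d : ℝ := (M : ℝ) + N with hd'
  set κ₁ : ℝ := (δ / (2 * d)) ^ (N - 1) / (4 * d) ^ (M + 1) / 2 with hκ₁
  have hκ₁0 : 0 < κ₁ := by positivity
  refine ⟨min (min 1 (1 / (4 * d))) κ₁, by positivity, (min_le_left _ _).trans (min_le_left _ _),
    fun κ hκ hle => ?_⟩
  have hle1 : κ ≤ 1 := hle.trans ((min_le_left _ _).trans (min_le_left _ _))
  have hle2 : κ ≤ 1 / (4 * d) := hle.trans ((min_le_left _ _).trans (min_le_right _ _))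
  have hle3 : κ ≤ κ₁ := hle.trans (min_le_right _ _)
  constructor
  · have h1 : κ ^ N ≤ κ := pow_le_of_le_one hκ.le hle1 (by omega)
    rw [le_div_iff₀ (by positivity)] at hle2
    nlinarith
  · have hexp : N * (M + 1) = M * (N - 1) + (M + N) := by
      obtain ⟨n, rfl⟩ : ∃ n, N = n + 1 := ⟨N - 1, by omega⟩
      simp only [Nat.add_sub_cancel]
      ring
    have h1 : κ ^ (M + N) ≤ κ := pow_le_of_le_one hκ.le hle1 (by omega)
    have h2 : (4 * d) ^ (M + 1) * κ ^ (M + N) < (δ / (2 * d)) ^ (N - 1) := by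
      calc (4 * d) ^ (M + 1) * κ ^ (M + N) ≤ (4 * d) ^ (M + 1) * κ₁ := by
            gcongr
            exact h1.trans hle3
        _ = (δ / (2 * d)) ^ (N - 1) / 2 := by rw [hκ₁]; field_simp
        _ < _ := half_lt_self (by positivity)
    calc (2 * d * (2 * κ ^ N)) ^ (M + 1)
        = (4 * d) ^ (M + 1) * κ ^ (N * (M + 1)) := by rw [pow_mul, ← mul_pow]; ring
      _ = ((4 * d) ^ (M + 1) * κ ^ (M + N)) * κ ^ (M * (N - 1)) := by rw [hexp, pow_add]; ring
      _ < (δ / (2 * d)) ^ (N - 1) * κ ^ (M * (N - 1)) := by gcongr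
      _ = (δ * κ ^ M / (2 * d)) ^ (N - 1) := by rw [pow_mul, ← mul_pow]; ring

end Invariant

theorem mainTheorem1 (M N : ℕ) (hM : 1 ≤ M) (hN : 1 ≤ N) : IsHAW (BadZero M N) := by
  have hM' : (1 : ℝ) ≤ M := by exact_mod_cast hM
  have hN' : (1 : ℝ) ≤ N := by exact_mod_cast hN
  have : Nonempty (Fin M × Fin N) := ⟨⟨0, hM⟩, ⟨0, hN⟩⟩
  have : Nontrivial (EuclideanSpace ℝ (Fin M × Fin N)) := inferInstance
  refine ⟨1 / 3, by norm_num, le_rfl, fun β hβ0 hβ => ?_⟩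
  have hβ1 : β < 1 := by linarith
  obtain ⟨l, hl⟩ : ∃ l : ℕ, (3 + 4 / β) * β ^ l ≤ β / 4 := by
    have hC : 0 < 3 + 4 / β := by positivity
    obtain ⟨l, hl⟩ := exists_pow_lt_of_lt_one
      (show 0 < β / 4 / (3 + 4 / β) by positivity) hβ1
    exact ⟨l, by rw [mul_comm]; exact ((lt_div_iff₀ hC).1 hl).le⟩
  obtain ⟨n, hn⟩ : ∃ n, n = N * (l + 1) + M * (l + 1) := ⟨_, rfl⟩
  have hn1 : 1 ≤ n := by rw [hn]; nlinarith
  -- the number of rounds in a stage: so many that the radius shrinks enough for the controlled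
  -- vectors to grow in spite of the constant `c` of the control
  obtain ⟨w, hw⟩ : ∃ w, w + n = 2 * n * (M + N) := ⟨2 * n * (M + N) - n, by
    apply Nat.sub_add_cancel; nlinarith⟩
  have hg : ∀ k : ℕ, 1 ≤ k → (β ^ (w + n)) ^ ((k : ℝ) / (M + N)) ≤ β ^ (2 * n) := by
    intro k hk
    rw [hw, ← Real.rpow_natCast, ← Real.rpow_mul hβ0.le]
    have e : ((2 * n * (M + N) : ℕ) : ℝ) * ((k : ℝ) / (M + N)) = ((2 * n * k : ℕ) : ℝ) := by
      push_cast
      field_simp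
    rw [e, Real.rpow_natCast]
    exact pow_le_pow_of_le_one hβ0.le hβ1.le (Nat.le_mul_of_pos_right _ hk)
  set δ : ℝ := β ^ (2 * (w + n)) with hδ
  have hδ0 : 0 < δ := by positivity
  have hδ1 : δ ≤ 1 := pow_le_one₀ hβ0.le hβ1.le
  obtain ⟨κ₁, hκ₁, hκ₁', H₁⟩ := exists_transference_const hM hN hδ0
  obtain ⟨κ₂, hκ₂, hκ₂', H₂⟩ := exists_transference_const hN hM hδ0
  set μ : ℝ := (N : ℝ) / (M + N) with hμ
  set ν : ℝ := (M : ℝ) / (M + N) with hν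
  let Inv : ℝ → GameBall (EuclideanSpace ℝ (Fin M × Fin N)) → Prop := fun κ B =>
    0 < κ ∧ κ ≤ κ₁ ∧ κ ≤ κ₂ ∧ ∀ v ∈ B.toSet,
      NoSmallVector (toMatrix v) B.radius (δ * κ ^ N * B.radius ^ μ) ∧
      NoSmallVector (toMatrix v).transpose B.radius (δ * κ ^ M * B.radius ^ ν)
  refine isBetaAbsoluteWinning_of_forces (Inv := Inv) (m := w + n - 1) hβ0 hβ ?_ ?_ ?_
  · -- for a suitable `κ` the invariant holds at the first ball of Bob, since every nonzero integer
    -- vector has size at least `min ρ 1`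
    intro B
    have hρ := B.radius_pos
    set τ : ℝ := min B.radius 1 / (B.radius ^ μ + B.radius ^ ν) with hτ
    have hm : 0 < min B.radius 1 := lt_min hρ one_pos
    have hs1 : 0 < B.radius ^ μ := by positivity
    have hs2 : 0 < B.radius ^ ν := by positivity
    set κ : ℝ := min (min κ₁ κ₂) τ with hκ
    have hκ0 : 0 < κ := by positivity
    have h1 : κ ≤ κ₁ := (min_le_left _ _).trans (min_le_left _ _)
    have h2 : κ ≤ κ₂ := (min_le_left _ _).trans (min_le_right _ _)
    have h3 : κ * (B.radius ^ μ + B.radius ^ ν) ≤ min B.radius 1 :=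
      (le_div_iff₀ (by positivity)).1 (min_le_right _ _)
    have h4 : ∀ k : ℕ, 1 ≤ k → δ * κ ^ k ≤ κ := fun k hk =>
      (mul_le_of_le_one_left (by positivity) hδ1).trans
        (pow_le_of_le_one hκ0.le (h1.trans hκ₁') (by omega))
    refine ⟨κ, hκ0, h1, h2, fun v _ => ⟨(noSmallVector_min _ hρ).mono ?_,
      (noSmallVector_min _ hρ).mono ?_⟩⟩
    · nlinarith [mul_le_mul_of_nonneg_right (h4 N hN) hs1.le]
    · nlinarith [mul_le_mul_of_nonneg_right (h4 M hM) hs2.le]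
  · rintro κ B ⟨hκ0, hκ1, hκ2, hB⟩
    rw [Nat.sub_add_cancel (by omega)]
    have hρ := B.radius_pos
    obtain ⟨hc1, hc2⟩ := hB B.center (Metric.mem_closedBall_self hρ.le)
    have hpow : ∀ k : ℕ, κ ^ k ≤ 1 := fun k => pow_le_one₀ hκ0.le (hκ1.trans hκ₁')
    have hδκ : ∀ k : ℕ, δ * κ ^ k ≤ 1 := fun k =>
      mul_le_one₀ hδ1 (by positivity) (hpow k)
    have hV := finrank_smallSpan_le hM (toMatrix B.center) hρ (η := 2 * κ ^ N) (θ := δ * κ ^ M)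
      (by positivity) (by positivity) (H₁ κ hκ0 hκ1).1 (by linarith [hδκ M]) (H₁ κ hκ0 hκ1).2 hc2
    have hV' := finrank_smallSpan_le hN (toMatrix B.center).transpose hρ (η := 2 * κ ^ M)
      (θ := δ * κ ^ N) (by positivity) (by positivity) (H₂ κ hκ0 hκ2).1 (by linarith [hδκ N])
      (H₂ κ hκ0 hκ2).2 (by rw [Matrix.transpose_transpose, add_comm (N : ℝ)]; exact hc1)
    rw [add_comm (N : ℝ)] at hV'
    refine (forces_controlled_pair isTensorLike_mulVecForm isTensorLike_transposeMulVecForm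
      hβ0 hβ1 hl hV hV' B hn w).mono ?_
    rintro B' ⟨⟨h1, h2⟩, h3, h4, h5⟩
    have hc0 : 0 < β ^ (2 * n) := by positivity
    have hc1 : β ^ (2 * n) ≤ 1 := pow_le_one₀ hβ0.le hβ1.le
    have hg0 : 0 < β ^ (w + n) := by positivity
    refine ⟨hκ0, hκ1, hκ2, fun v hv => ⟨?_, ?_⟩⟩
    · exact noSmallVector_of_controlled isTensorLike_mulVecForm (mat := toMatrix)
        (fun _ _ => rfl) h3 (by positivity) hδ0 hδ1 (by positivity) hc0 hc1 hg0 (hg N hN)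
        h4 h5 h1 hv (hB v (h3 hv)).1
    · exact noSmallVector_of_controlled isTensorLike_transposeMulVecForm
        (mat := fun v => (toMatrix v).transpose)
        (fun _ _ => rfl) h3 (by positivity) hδ0 hδ1 (by positivity) hc0 hc1 hg0 (hg M hM)
        h4 h5 h2 hv (hB v (h3 hv)).2
  · intro κ x ρ₀ c₀ hρ₀ hc₀ h
    have hκ : 0 < κ := by
      obtain ⟨B, hB, -⟩ := h ρ₀ hρ₀ le_rfl
      exact hB.1
    refine mem_badZero_of_noSmallVector hM hN (D := δ * κ ^ N) (by positivity) hρ₀ hc₀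
      fun R hR hR' => ?_
    obtain ⟨B, hB, hx, h1, h2⟩ := h R hR hR'
    exact ⟨B.radius, h1, h2, (hB.2.2.2 x hx).1⟩
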